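/- Let $n\ge 1$, $k\ge 2$, $V=\{1,\dots,n\}$ and $D=\{0,1,\dots,k\}^V$; $x(e)=0$ means that $x\in D$ gives no type to $e$, and $X_i=\{e: x(e)=i\}$ for $1\le i\le k$. A function $f:D\to\mathbb R$ is *$k$-submodular* if $f(x)+f(y)\ge f(x\sqcup y)+f(x\sqcap y)$ for all $x,y\in D$, where the $i$-th sets of $x\sqcap y$ and $x\sqcup y$ are $X_i\cap Y_i$ and $(X_i\cup Y_i)\setminus\bigcup_{j\ne i}(X_j\cup Y_j)$. Monotonicity is not assumed. **Bandit problem.** In round $t=1,\dots,T$ a learner plays an action $A_t\in D$ (there are no constraints) and observes only the reward $f_t(A_t)$. The random functions $f_t:D\to[0,1]$ are independent over time, for every $A\in D$ the rewards $f_t(A)$ are identically distributed over $t$, and $f(A)=\mathbb E[f_t(A)]$ is $k$-submodular. The expected cumulative $\tfrac12$-regret is $\tfrac12\,T f(\mathrm{OPT})-\mathbb E\big[\sum_{t=1}^T f_t(A_t)\big]$, where $\mathrm{OPT}\in\arg\max_{A\in D}f(A)$ and the expectation is over the rewards and the randomness of the learner. **Offline algorithm $\mathcal A$** (Iwata, Tanigawa,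 Yoshida), with access to a value oracle. Start with $s=0$. For each $e\in V$, in an arbitrary fixed order: let $y_i$ be the oracle value of $s$ with $s(e)$ changed to $i$, minus the known value of $s$ (for $s\neq 0$ this is the value already obtained from the oracle), for $i=1,\dots,k$; relabel the types so that $y_1\ge\dots\ge y_k$ (ties being broken by any fixed measurable rule); let $i^+$ be the largest $i$ with $y_i>0$, and $i^+=0$ if $y_1\le 0$. Choose $s(e)=i$ with probability $p_i$, with randomness independent of everything else, where - $p_1=1$ if $i^+\le 1$; - $p_i=y_i/(y_1+y_2)$ for $i=1,2$ if $i^+=2$; - $p_{i^+}=2^{-(i^+-1)}$ and $p_i=2^{-i}$ for $i<i^+$ if $i^+\ge 3$; and all other $p_i$ are $0$. Output $s$. The value of $s=0$ is either normalized to $0$ and not queried ($nk$ queries), or queried once at the beginning; the result below holds for both variants. **C-ETC.** Put $\delta=20n$, $N=nk$ and $m=\left\lceil \frac{\delta^{2/3}T^{2/3}\log(T)^{1/3}}{2N^{2/3}}\right\rceil$. Run $\mathcal A$; whenever $\mathcal A$ queries the value of an action, play that action $m$ times and return the empirical mean of the $m$ observed rewards to $\mathcal A$. When $\mathcal A$ has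 stopped, play its output in all remaining rounds. (If round $T$ is reached earlier, the process ends there.) **Statement.** There is an absolute constant $C>0$ such that for all $n\ge1$, $k\ge2$, $T\ge nk$ and all bandit problems as above, the expected cumulative $\tfrac12$-regret of C-ETC with the subroutine $\mathcal A$ is at most $$C\,n\,k^{1/3}\,T^{2/3}\,\log(T)^{1/3}.$$ -/

import Mathlib

open MeasureTheory ProbabilityTheory

noncomputable section

/-! ### `k`-submodular functions -/

/-- An element of `(k+1)^V` with `V = Fin n`: every element receives a type in `Fin k`, or no type
(`none`, written `0` on paper). The `i`-th set of the corresponding tuple of pairwise disjoint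
subsets of `V` is `{e | x e = some i}`. -/
abbrev Assignment (n k : ℕ) : Type := Fin n → Option (Fin k)

namespace Assignment

/-- The assignment of no type to any element, i.e. the tuple of empty sets. -/
def empty (n k : ℕ) : Assignment n k := fun _ => none

/-- Give the element `e` the type `i`. -/
def assign {n k : ℕ} (x : Assignment n k) (e : Fin n) (i : Fin k) : Assignment n k :=
  Function.update x e (some i)

/-- `x ⊓ y`: its `i`-th set is the intersection `X i ∩ Y i`. -/
def meet {n k : ℕ} (x y : Assignment n k) : Assignment n k := fun e =>
  if x e = y e then x e else none

/-- `x ⊔ y`: its `i`-th set is `X i ∪ Y i` without the sets `X j ∪ Y j`, `j ≠ i`. -/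
def join {n k : ℕ} (x y : Assignment n k) : Assignment n k := fun e =>
  match x e, y e with
  | none, b => b
  | some i, none => some i
  | some i, some j => if i = j then some i else none

end Assignment

/-- `k`-submodularity. -/
def IsKSubmodular {n k : ℕ} (f : Assignment n k → ℝ) : Prop :=
  ∀ x y, f (Assignment.join x y) + f (Assignment.meet x y) ≤ f x + f y

/-! ### Offline algorithms with a value oracle, and C-ETC -/

/-- A deterministic algorithm with a value oracle on the domain `D`: it either stops and outputs an
element of `D`, or queries the value of some element and continues depending on the answer.
A randomized algorithm is such an algorithm depending on a random seed. -/
inductive OracleAlg (D : Type) : Type where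
  | output (S : D) : OracleAlg D
  | query (A : D) (cont : ℝ → OracleAlg D) : OracleAlg D

/-- The action that C-ETC (with `m` repetitions per query, and the given offline algorithm as a
subroutine) plays in round `t = 0, 1, 2, …`, when playing action `A` in round `t` yields the
reward `r t A`. As long as the offline algorithm queries actions, each queried action is played
`m` times and the empirical mean of the `m` received rewards is returned as the answer; then the
output is played for ever. Only the rewards of the actions actually played are used. -/
def cetcAction {D : Type} (m : ℕ) : OracleAlg D → (ℕ → D → ℝ) → ℕ → D
  | .output S, _, _ => S
  | .query A cont, r, t =>
      if t < m then A
      else cetcAction m (cont ((∑ i ∈ Finset.range m, r i A) / m)) (fun i => r (m + i)) (t - m)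

/-- The number of repetitions chosen by C-ETC with horizon `T` for a subroutine with robustness
parameter `δ` and query bound `N`. -/
def cetcRepetitions (δ N : ℝ) (T : ℕ) : ℕ :=
  ⌈δ ^ (2 / 3 : ℝ) * (T : ℝ) ^ (2 / 3 : ℝ) * Real.log T ^ (1 / 3 : ℝ) / (2 * N ^ (2 / 3 : ℝ))⌉₊

/-! ### The randomized offline algorithm of Iwata, Tanigawa and Yoshida -/

/-- For gains `z` sorted in decreasing order, with positions counted from `1`: the largest position
carrying a positive gain, and `0` if there is none. -/
def lastPositive {k : ℕ} (z : Fin k → ℝ) : ℕ :=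
  open Classical in
  (Finset.univ.filter fun j : Fin k => 0 < z j).sup fun j => (j : ℕ) + 1

/-- The probability with which the type at each position is chosen, for gains `z` sorted in
decreasing order. The element `j : Fin k` stands for the position `j + 1`. -/
def typeProb {k : ℕ} (z : Fin k → ℝ) (j : Fin k) : ℝ :=
  if lastPositive z ≤ 1 then
    if (j : ℕ) + 1 = 1 then 1 else 0
  else if lastPositive z = 2 then
    if (j : ℕ) + 1 ≤ 2 then
      z j / ∑ l ∈ Finset.univ.filter (fun l : Fin k => (l : ℕ) + 1 ≤ 2), z l
    else 0
  else if (j : ℕ) + 1 = lastPositive z then (1 / 2 : ℝ) ^ (lastPositive z - 1)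
  else if (j : ℕ) + 1 < lastPositive z then (1 / 2 : ℝ) ^ ((j : ℕ) + 1)
  else 0

/-- Sampling from the probability vector `p` by means of a uniform seed `u ∈ [0, 1]`: the first `j`
with `u < p 0 + ⋯ + p j`. (For a probability vector there is such a `j` unless `u = 1`.) -/
def sampleIndex {k : ℕ} (p : Fin k → ℝ) (u : ℝ) : Option (Fin k) :=
  open Classical in
  (List.finRange k).find? fun j => decide (u < ∑ l ∈ Finset.Iic j, p l)

/-- Query the values of `s` with `e` given type `i`, for all `i` in the list, record the answers in
`w`, and continue with `cont`. -/
def queryTypes {n k : ℕ} (s : Assignment n k) (e : Fin n) :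
    List (Fin k) → (Fin k → ℝ) → ((Fin k → ℝ) → OracleAlg (Assignment n k)) →
      OracleAlg (Assignment n k)
  | [], w, cont => cont w
  | i :: l, w, cont =>
      .query (Assignment.assign s e i) fun v => queryTypes s e l (Function.update w i v) cont

/-- The main loop over the list of remaining elements. Here `s` is the current solution, `v` its
value as known to the algorithm, `u e` the seed used to choose the type of `e`, and `σ y` the
permutation that sorts the marginal gains `y` in decreasing order. The value of the new solution is
one of the values that have just been queried. -/
def randomizedLoop {n k : ℕ} (σ : (Fin k → ℝ) → Equiv.Perm (Fin k)) (u : Fin n → ℝ) :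
    List (Fin n) → Assignment n k → ℝ → OracleAlg (Assignment n k)
  | [], s, _ => .output s
  | e :: es, s, v =>
      queryTypes s e (List.finRange k) 0 fun w =>
        let y : Fin k → ℝ := fun i => w i - v
        match sampleIndex (typeProb fun j => y (σ y j)) (u e) with
        | none => randomizedLoop σ u es s v
        | some j => randomizedLoop σ u es (Assignment.assign s e (σ y j)) (w (σ y j))

/-- The randomized algorithm for unconstrained `k`-submodular maximization, going through the
elements in the order `ord 0, ord 1, …`, with seed `u`. If `queryEmpty` is true, the value
of the empty assignment is queried at the beginning (`n * k + 1` queries altogether); otherwise it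
is taken to be normalized to `0` and not queried (`n * k` queries). -/
def randomizedKSubmodularMax {n k : ℕ} (queryEmpty : Bool) (ord : Equiv.Perm (Fin n))
    (σ : (Fin k → ℝ) → Equiv.Perm (Fin k)) (u : Fin n → ℝ) : OracleAlg (Assignment n k) :=
  if queryEmpty then
    .query (Assignment.empty n k) fun v =>
      randomizedLoop σ u ((List.finRange n).map ord) (Assignment.empty n k) v
  else randomizedLoop σ u ((List.finRange n).map ord) (Assignment.empty n k) 0

/-! ### Stochastic bandits -/

/-- `r t ω A` is the reward `f_t(A)` of action `A` in round `t`. The reward functions `f_t` are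
independent over time, and for every action its rewards are identically distributed over time and
lie in `[0, 1]`. (Rewards of different actions in the same round may be dependent.) -/
structure IsStochasticReward {Ω D : Type*} [MeasurableSpace Ω] (P : Measure Ω)
    (r : ℕ → Ω → D → ℝ) : Prop where
  measurable : ∀ t, Measurable (r t)
  indep : iIndepFun r P
  identDistrib : ∀ t A, IdentDistrib (fun ω => r t ω A) (fun ω => r 0 ω A) P P
  bounded : ∀ t A, ∀ᵐ ω ∂P, r t ω A ∈ Set.Icc (0 : ℝ) 1

/-- The seed `U` consists of independent random variables that are uniform on `[0, 1]`, and it is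
independent of all rewards. -/
structure IsUniformSeed {Ω D ι : Type*} [MeasurableSpace Ω] (P : Measure Ω)
    (r : ℕ → Ω → D → ℝ) (U : ι → Ω → ℝ) : Prop where
  measurable : ∀ e, Measurable (U e)
  uniform : ∀ e, P.map (U e) = volume.restrict (Set.Icc (0 : ℝ) 1)
  indep : iIndepFun U P
  indep_rewards : IndepFun (fun ω t => r t ω) (fun ω e => U e ω) P

/-- The expected reward function `f(A) = 𝔼[f_t(A)]`. -/
def meanReward {Ω D : Type*} [MeasurableSpace Ω] (P : Measure Ω) (r : ℕ → Ω → D → ℝ) (A : D) : ℝ :=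
  ∫ ω, r 0 ω A ∂P

/-- The total reward `∑_{t < T} f_t(A_t)` received when action `A t ω` is played in round `t`. -/
def totalReward {Ω D : Type*} (r : ℕ → Ω → D → ℝ) (A : ℕ → Ω → D) (T : ℕ) (ω : Ω) : ℝ :=
  ∑ t ∈ Finset.range T, r t ω (A t ω)

/-- The expected cumulative `α`-regret `α T f(OPT) - 𝔼[∑_{t < T} f_t(A_t)]`. -/
def expectedRegret {Ω D : Type*} [MeasurableSpace Ω] (P : Measure Ω) (α : ℝ) (r : ℕ → Ω → D → ℝ)
    (A : ℕ → Ω → D) (T : ℕ) (opt : D) : ℝ :=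
  α * T * meanReward P r opt - ∫ ω, totalReward r A T ω ∂P

/-- The actions of C-ETC with horizon `T`, using the randomized algorithm with random seed `U` as a
`(1/2, 20 n, n k)`-robust subroutine. -/
def cetcRandomized {Ω : Type*} {n k : ℕ} (queryEmpty : Bool) (ord : Equiv.Perm (Fin n))
    (σ : (Fin k → ℝ) → Equiv.Perm (Fin k)) (r : ℕ → Ω → Assignment n k → ℝ)
    (U : Fin n → Ω → ℝ) (T : ℕ) (t : ℕ) (ω : Ω) : Assignment n k :=
  cetcAction (cetcRepetitions (20 * n) (n * k) T)
    (randomizedKSubmodularMax queryEmpty ord σ fun e => U e ω) (fun i => r i ω) t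

end

/-! ### Properties of `k`-submodular functions -/

section KSubmodular

variable {n k : ℕ} {f : Assignment n k → ℝ}

/-! The offline algorithm is analysed directly with noisy answers, in expectation. By pairwise
monotonicity, OPT can be completed to a total assignment `o` without loss. Whenever the algorithm
gives a type to an element, `o` is changed there to agree with the current solution `s`, so that
both end at the output. With exact answers the probabilities are such that the expected loss of `f
o` at an element is at most the expected gain of `f s`. Hence `f s + f o` does not decrease in
expectation, and it ends as twice the value of the output; this is the source of the factor 1/2. The
combinatorial core is `sum_exchange_le_of_weights`.

If the gains are known up to an error `d`, the exchange inequality survives with a loss of `4 * d`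
(`sum_typeProb_exchange_le`). The known value of `s` is itself an earlier noisy answer whose error
reappears in the next step, so `potential` charges for it in advance, and `potential_step` shows
that one element costs at most ten times the error of its own answers. The actions queried for an
element are determined by the past, while their rewards and the seed of the element are fresh. One
can therefore fix the current state and average over what follows
(`integral_le_integral_of_indepFun`). Hoeffding's inequality bounds the expected error of the `k`
answers by `meanError`, and `le_integral_randomizedLoop` adds up the losses by induction over the
elements.

In the regret, an exploration round costs at most 1 and a later round O(n) times `meanError`. With
an accuracy of order (k log T / T)^(1/3), the number of repetitions of C-ETC makes both totals of
the claimed order (`exists_cetcRepetitions_bound`). -/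

/-- A `k`-submodular function is pairwise monotone. -/
theorem IsKSubmodular.pairwise_monotone (hf : IsKSubmodular f) {x : Assignment n k} {e : Fin n}
    (hx : x e = none) {i j : Fin k} (hij : i ≠ j) :
    2 * f x ≤ f (Assignment.assign x e i) + f (Assignment.assign x e j) := by
  have h := hf (Assignment.assign x e i) (Assignment.assign x e j)
  -- Two different types at `e` cancel in the join as well as in the meet, so both are `x`.
  have h1 : Assignment.join (Assignment.assign x e i) (Assignment.assign x e j) = x := by
    funext e'
    by_cases he : e' = e
    · subst he
      simp [Assignment.join, Assignment.assign, hij, hx]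
    · simp only [Assignment.join, Assignment.assign, Function.update_of_ne he]
      cases x e' <;> simp
  have h2 : Assignment.meet (Assignment.assign x e i) (Assignment.assign x e j) = x := by
    funext e'
    by_cases he : e' = e
    · subst he
      simp [Assignment.meet, Assignment.assign, hij, hx]
    · simp [Assignment.meet, Assignment.assign, Function.update_of_ne he]
  rw [h1, h2] at h
  linarith

/-- A `k`-submodular function has decreasing marginal gains. -/
theorem IsKSubmodular.assign_sub_antitone (hf : IsKSubmodular f) {x y : Assignment n k}
    (hxy : ∀ e', x e' = none ∨ x e' = y e') {e : Fin n} (hy : y e = none) (i : Fin k) :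
    f (Assignment.assign y e i) - f y ≤ f (Assignment.assign x e i) - f x := by
  have h := hf (Assignment.assign x e i) y
  have hx : x e = none := by rcases hxy e with h | h <;> simp [h, hy]
  -- As `y` extends `x`, the join adds the type to `y` and the meet removes it from `x`:
  -- `k`-submodularity of this pair is the claim.
  have h1 : Assignment.join (Assignment.assign x e i) y = Assignment.assign y e i := by
    funext e'
    by_cases he : e' = e
    · subst he
      simp [Assignment.join, Assignment.assign, hy]
    · simp only [Assignment.join, Assignment.assign, Function.update_of_ne he]
      rcases hxy e' with h | h
      · simp [h]
      · rw [h]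
        cases y e' <;> simp
  have h2 : Assignment.meet (Assignment.assign x e i) y = x := by
    funext e'
    by_cases he : e' = e
    · subst he
      simp [Assignment.meet, Assignment.assign, hy, hx]
    · simp only [Assignment.meet, Assignment.assign, Function.update_of_ne he]
      rcases hxy e' with h | h <;> simp [h]
  rw [h1, h2] at h
  linarith

/-- Every assignment can be extended to a total one without decreasing a `k`-submodular function,
provided there are at least two types. -/
theorem IsKSubmodular.exists_total_le (hf : IsKSubmodular f) (hk : 2 ≤ k) (x : Assignment n k) :
    ∃ y : Assignment n k, (∀ e, y e ≠ none) ∧ f x ≤ f y := by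
  induction h : (Finset.univ.filter fun e => x e = none).card generalizing x with
  | zero =>
    refine ⟨x, fun e he => ?_, le_rfl⟩
    rw [Finset.card_eq_zero, Finset.filter_eq_empty_iff] at h
    exact h (Finset.mem_univ e) he
  | succ N ih =>
    obtain ⟨e, he⟩ : (Finset.univ.filter fun e => x e = none).Nonempty :=
      Finset.card_pos.1 (by omega)
    have hx : x e = none := (Finset.mem_filter.1 he).2
    have key : ∀ i : Fin k, ∃ y : Assignment n k, (∀ e, y e ≠ none) ∧
        f (Assignment.assign x e i) ≤ f y := by
      intro i
      apply ih
      have : (Finset.univ.filter fun e' => Assignment.assign x e i e' = none) =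
          (Finset.univ.filter fun e => x e = none).erase e := by
        ext e'
        simp only [Finset.mem_filter, Finset.mem_univ, true_and, Finset.mem_erase]
        by_cases h' : e' = e
        · simp [h', Assignment.assign]
        · simp [h', Assignment.assign]
      rw [this, Finset.card_erase_of_mem he, h]
      simp
    -- The average over two types at `e` is at least `f x`, so the better of the two does not
    -- decrease `f`.
    have hm := hf.pairwise_monotone hx (i := ⟨0, by omega⟩) (j := ⟨1, by omega⟩) (by simp)
    rcases le_total (f (Assignment.assign x e ⟨0, by omega⟩))
      (f (Assignment.assign x e ⟨1, by omega⟩)) with h' | h'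
    · obtain ⟨y, hy, hxy⟩ := key ⟨1, by omega⟩
      exact ⟨y, hy, by linarith⟩
    · obtain ⟨y, hy, hxy⟩ := key ⟨0, by omega⟩
      exact ⟨y, hy, by linarith⟩

/-- Lowering the value at the empty assignment preserves `k`-submodularity. -/
theorem IsKSubmodular.update_empty (hf : IsKSubmodular f) {c : ℝ}
    (hc : c ≤ f (Assignment.empty n k)) :
    IsKSubmodular (Function.update f (Assignment.empty n k) c) := by
  intro x y
  have hle : ∀ z, Function.update f (Assignment.empty n k) c z ≤ f z := by
    intro z
    by_cases hz : z = Assignment.empty n k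
    · simp [hz, hc]
    · simp [Function.update_of_ne hz]
  -- If one argument is empty, join and meet are the two arguments again and equality holds.
  -- Otherwise the right-hand side is unchanged and the left-hand side can only drop.
  by_cases hx : x = Assignment.empty n k
  · have h1 : Assignment.join x y = y := by
      funext e
      simp [hx, Assignment.join, Assignment.empty]
    have h2 : Assignment.meet x y = x := by
      funext e
      simp [hx, Assignment.meet, Assignment.empty]
    rw [h1, h2, add_comm]
  by_cases hy : y = Assignment.empty n k
  · have h1 : Assignment.join x y = x := by
      funext e
      simp only [hy, Assignment.join, Assignment.empty]
      cases x e <;> simp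
    have h2 : Assignment.meet x y = y := by
      funext e
      simp only [hy, Assignment.meet, Assignment.empty]
      cases x e <;> simp
    rw [h1, h2]
  · rw [Function.update_of_ne hx, Function.update_of_ne hy]
    exact (add_le_add (hle _) (hle _)).trans (hf x y)

end KSubmodular

/-! ### The probabilities of the types -/

section TypeProb

/-- The exchange inequality for weights that decrease at least geometrically. -/
theorem sum_exchange_le_of_weights {k : ℕ} (hk : 2 ≤ k) {p a y : Fin k → ℝ} {t : Fin k}
    (hp : ∀ j, 0 ≤ p j) (hsum : ∑ j, p j = 1) (hhalf : ∀ j, p j ≤ 1 / 2)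
    (hthird : ∀ i j, i < j → p j ≤ 1 / 3) (ht : 1 ≤ ∑ j ∈ Finset.Iio t, p j + 2 * p t)
    (hay : ∀ j, a j ≤ y j) (hy : Antitone y) (hpos : ∀ j, p j ≠ 0 → 0 ≤ y j)
    (ha : ∀ i j, i ≠ j → 0 ≤ a i + a j) :
    ∑ j, p j * (a t - a j) ≤ ∑ j, p j * y j := by
  have hpy : ∀ j, 0 ≤ p j * y j := by
    intro j
    by_cases h : p j = 0
    · simp [h]
    · exact mul_nonneg (hp j) (hpos j h)
  -- If `a t ≤ 0`, every other `a j` is at least `-a t ≥ a t`, so no term on the left is positive.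
  rcases le_or_gt (a t) 0 with hat | hat
  · apply Finset.sum_le_sum
    intro j _
    refine le_trans ?_ (hpy j)
    by_cases hj : j = t
    · simp [hj]
    · have := ha j t hj
      exact mul_nonpos_of_nonneg_of_nonpos (hp j) (by linarith)
  obtain ⟨l, hl, hmin⟩ : ∃ l ∈ Finset.univ.erase t, ∀ j ∈ Finset.univ.erase t, a l ≤ a j := by
    apply Finset.exists_min_image
    rw [← Finset.card_pos, Finset.card_erase_of_mem (Finset.mem_univ _)]
    simp
    omega
  have hlt : l ≠ t := Finset.ne_of_mem_erase hl
  -- At most one `a j` is negative, since pairs have nonnegative sums. If it exists, it is `a l ≥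
  -- -b`, and then all others are at least `b`.
  obtain ⟨b, hb⟩ : ∃ b, b = max 0 (-a l) := ⟨_, rfl⟩
  have hb0 : 0 ≤ b := hb ▸ le_max_left _ _
  have hbl : -b ≤ a l := by have := hb ▸ le_max_right 0 (-a l); linarith
  have hba : ∀ j, j ≠ t → j ≠ l → b ≤ a j := by
    intro j hj hjl
    have h1 := hmin j (by simp [hj])
    have h2 := ha j l hjl
    rw [hb]
    exact max_le (by linarith) (by linarith)
  have hbt : b ≤ a t := by
    have h2 := ha t l hlt.symm
    rw [hb]
    exact max_le hat.le (by linarith)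
  -- Lower bounds for `y j - (a t - a j)`: before `t` use `y j ≥ y t ≥ a t`, at `t` use `y t ≥ a t`,
  -- after `t` use `y j ≥ a j`. The exceptional index `l` is corrected by `2 * b` before `t`, and by
  -- `3 * b` after `t`, where only `y l ≥ 0` is used.
  have hpt : ∀ j, p j * ((if j < t then b else 0) + (if j = t then a t else 0) +
      (if t < j then 2 * b - a t else 0) -
      (if j = l then (if l < t then 2 * b else 3 * b) else 0)) ≤
      p j * y j - p j * (a t - a j) := by
    intro j
    rw [← mul_sub]
    by_cases h0 : p j = 0
    · simp [h0]
    apply mul_le_mul_of_nonneg_left _ (hp j)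
    have hj0 := hpos j h0
    rcases lt_trichotomy j t with h | h | h
    · have hyt := hy h.le
      have := hay t
      by_cases hjl : j = l
      · subst hjl
        simp [h, h.ne, h.not_gt]
        linarith
      · simp [h, h.ne, h.not_gt, hjl]
        have := hba j h.ne hjl
        linarith
    · subst h
      simp [hlt.symm]
      exact hay j
    · have := hay j
      by_cases hjl : j = l
      · subst hjl
        simp [h, h.ne', h.not_gt]
        linarith
      · simp [h, h.ne', h.not_gt, hjl]
        have := hba j h.ne' hjl
        linarith
  have hS := Finset.sum_le_sum fun j (_ : j ∈ Finset.univ) => hpt j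
  rw [Finset.sum_sub_distrib] at hS
  have hlo : ∑ j, p j = ∑ j ∈ Finset.Iio t, p j + p t + ∑ j ∈ Finset.Ioi t, p j := by
    rw [← Finset.sum_filter_add_sum_filter_not Finset.univ (fun j => j < t),
      ← Finset.sum_filter_add_sum_filter_not (Finset.univ.filter fun j => ¬ j < t) (fun j => j = t),
      Finset.filter_filter, Finset.filter_filter, add_assoc]
    congr 1
    · apply Finset.sum_congr _ fun _ _ => rfl
      ext; simp
    congr 1
    · rw [← Finset.sum_singleton p t]
      apply Finset.sum_congr _ fun _ _ => rfl
      ext j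
      simp only [Finset.mem_filter, Finset.mem_univ, true_and, Finset.mem_singleton]
      exact ⟨fun h => h.2, fun h => ⟨by simp [h], h⟩⟩
    · apply Finset.sum_congr _ fun _ _ => rfl
      ext j
      simp only [Finset.mem_filter, Finset.mem_univ, true_and, Finset.mem_Ioi, not_lt]
      exact ⟨fun h => lt_of_le_of_ne h.1 (Ne.symm h.2), fun h => ⟨h.le, h.ne'⟩⟩
  have hS' : (∑ j ∈ Finset.Iio t, p j) * b + p t * a t +
      (∑ j ∈ Finset.Ioi t, p j) * (2 * b - a t) - p l * (if l < t then 2 * b else 3 * b) ≤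
      ∑ j, p j * y j - ∑ j, p j * (a t - a j) := by
    refine le_of_eq_of_le ?_ hS
    simp only [mul_sub, mul_add, Finset.sum_sub_distrib, Finset.sum_add_distrib, mul_ite, mul_zero,
      Finset.sum_ite_eq', Finset.mem_univ, if_true]
    rw [← Finset.sum_filter, ← Finset.sum_filter, ← Finset.sum_mul]
    have e1 : (Finset.univ.filter fun j => j < t) = Finset.Iio t := by ext; simp
    have e2 : (Finset.univ.filter fun j => t < j) = Finset.Ioi t := by ext; simp
    rw [e1, e2, Finset.sum_sub_distrib, ← Finset.sum_mul, ← Finset.sum_mul]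
  -- The bounds 1/2 and 1/3 on the weights are exactly what limits the correction to `b`. What
  -- remains after eliminating the weights beyond `t` is the product in `h4`.
  have h3 : p l * (if l < t then 2 * b else 3 * b) ≤ b := by
    split_ifs with h
    · nlinarith [hhalf l]
    · nlinarith [hthird t l (lt_of_le_of_ne (not_lt.1 h) hlt.symm)]
  have h4 : 0 ≤ (a t - b) * (∑ j ∈ Finset.Iio t, p j + 2 * p t - 1) :=
    mul_nonneg (by linarith) (by linarith)
  have h5 : ∑ j ∈ Finset.Ioi t, p j = 1 - ∑ j ∈ Finset.Iio t, p j - p t := by linarith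
  rw [h5] at hS'
  nlinarith

variable {k : ℕ} {z : Fin k → ℝ}

theorem lastPositive_le (z : Fin k → ℝ) : lastPositive z ≤ k := by
  classical
  unfold lastPositive
  exact Finset.sup_le fun j _ => j.2

/-- For sorted gains the positive ones occupy an initial segment of the positions. -/
theorem succ_le_lastPositive_iff (hz : Antitone z) (j : Fin k) :
    (j : ℕ) + 1 ≤ lastPositive z ↔ 0 < z j := by
  classical
  constructor
  · intro h
    unfold lastPositive at h
    obtain ⟨i, hi, hji⟩ := (Finset.le_sup_iff (Nat.succ_pos _)).1 h
    have h1 : j ≤ i := Fin.le_def.2 (Nat.le_of_succ_le_succ hji)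
    have h2 : 0 < z i := (Finset.mem_filter_univ i).1 hi
    exact lt_of_lt_of_le h2 (hz h1)
  · intro h
    exact Finset.le_sup (f := fun j : Fin k => (j : ℕ) + 1) (by simp [h])

theorem sum_range_half_pow (N : ℕ) :
    ∑ i ∈ Finset.range N, (1 / 2 : ℝ) ^ (i + 1) = 1 - (1 / 2 : ℝ) ^ N := by
  induction N with
  | zero => simp
  | succ N ih => rw [Finset.sum_range_succ, ih, pow_succ]; ring

theorem typeProb_of_lastPositive_le_one (h : lastPositive z ≤ 1) (j : Fin k) :
    typeProb z j = if (j : ℕ) = 0 then 1 else 0 := by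
  simp [typeProb, h]

theorem typeProb_of_lastPositive_eq_two {k : ℕ} {z : Fin (k + 2) → ℝ} (h : lastPositive z = 2)
    (j : Fin (k + 2)) :
    typeProb z j = if j = 0 then z 0 / (z 0 + z 1) else if j = 1 then z 1 / (z 0 + z 1) else 0 := by
  have e : (Finset.univ.filter fun l : Fin (k + 2) => (l : ℕ) + 1 ≤ 2) = {0, 1} := by
    ext l
    simp only [Finset.mem_filter, Finset.mem_univ, true_and, Finset.mem_insert,
      Finset.mem_singleton, Fin.ext_iff, Fin.val_zero, Fin.val_one]
    omega
  simp only [typeProb, h, e]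
  rw [Finset.sum_pair (by simp)]
  by_cases h0 : j = 0
  · simp [h0]
  by_cases h1 : j = 1
  · simp [h1]
  · have : ¬ (j : ℕ) ≤ 1 := by
      simp only [Fin.ext_iff, Fin.val_zero, Fin.val_one] at h0 h1
      omega
    simp [h0, h1, this]

theorem typeProb_of_three_le_lastPositive (h : 3 ≤ lastPositive z) (j : Fin k) :
    typeProb z j = if (j : ℕ) + 1 = lastPositive z then (1 / 2 : ℝ) ^ (lastPositive z - 1)
      else if (j : ℕ) + 1 < lastPositive z then (1 / 2 : ℝ) ^ ((j : ℕ) + 1) else 0 := by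
  have h1 : ¬ lastPositive z ≤ 1 := by omega
  have h2 : ¬ lastPositive z = 2 := by omega
  simp [typeProb, h1, h2]

theorem typeProb_nonneg (hz : Antitone z) (j : Fin k) : 0 ≤ typeProb z j := by
  unfold typeProb
  split_ifs with h1 _ h2
  all_goals try positivity
  have hpos : ∀ l : Fin k, (l : ℕ) + 1 ≤ 2 → 0 ≤ z l := fun l hl =>
    ((succ_le_lastPositive_iff hz l).1 (h2 ▸ hl)).le
  exact div_nonneg (hpos j ‹_›) (Finset.sum_nonneg fun l hl => hpos l (Finset.mem_filter.1 hl).2)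

/-- In the geometric case the last positive position receives the whole tail that is missing to 1.
-/
theorem sum_typeProb (hk : 2 ≤ k) (hz : Antitone z) : ∑ j, typeProb z j = 1 := by
  obtain ⟨k, rfl⟩ := Nat.exists_eq_add_of_le' hk
  rcases (by omega : lastPositive z ≤ 1 ∨ lastPositive z = 2 ∨ 3 ≤ lastPositive z) with h | h | h
  · simp_rw [typeProb_of_lastPositive_le_one h]
    rw [Fin.sum_univ_eq_sum_range (fun i => if i = 0 then (1 : ℝ) else 0)]
    simp
  · simp_rw [typeProb_of_lastPositive_eq_two h]
    have h0 : 0 < z 0 := (succ_le_lastPositive_iff hz 0).1 (by simp [h])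
    have h1 : 0 < z 1 := (succ_le_lastPositive_iff hz 1).1 (by simp [h])
    rw [Finset.sum_eq_add_of_mem 0 1 (by simp) (by simp) (by simp)]
    · simp
      field_simp
    · rintro c - ⟨hc0, hc1⟩
      simp [hc0, hc1]
  · simp_rw [typeProb_of_three_le_lastPositive h]
    rw [Fin.sum_univ_eq_sum_range (fun i => if i + 1 = lastPositive z then
      (1 / 2 : ℝ) ^ (lastPositive z - 1) else if i + 1 < lastPositive z then (1 / 2 : ℝ) ^ (i + 1)
      else 0)]
    obtain ⟨L, hL⟩ : ∃ L, lastPositive z = L + 1 := ⟨lastPositive z - 1, by omega⟩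
    have hle := lastPositive_le z
    rw [hL] at hle ⊢
    rw [← Finset.sum_subset (Finset.range_mono hle), Finset.sum_range_succ]
    · have : ∀ i ∈ Finset.range L, (if i + 1 = L + 1 then (1 / 2 : ℝ) ^ (L + 1 - 1) else
          if i + 1 < L + 1 then (1 / 2 : ℝ) ^ (i + 1) else 0) = (1 / 2 : ℝ) ^ (i + 1) := by
        intro i hi
        have := Finset.mem_range.1 hi
        rw [if_neg (by omega), if_pos (by omega)]
      rw [Finset.sum_congr rfl this, sum_range_half_pow]
      simp
    · intro i _ hi
      have := Finset.mem_range.not.1 hi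
      rw [if_neg (by omega), if_neg (by omega)]

/-- The exchange inequality for the probabilities used by the algorithm, with gains known up to
an error `d`. -/
theorem sum_typeProb_exchange_le (hk : 2 ≤ k) (hz : Antitone z) {a : Fin k → ℝ} {d : ℝ}
    (hd : 0 ≤ d) (haz : ∀ j, a j ≤ z j + d) (ha : ∀ i j, i ≠ j → 0 ≤ a i + a j) (t : Fin k) :
    ∑ j, typeProb z j * (a t - a j) ≤ ∑ j, typeProb z j * z j + 4 * d := by
  have hp := typeProb_nonneg hz
  have hs := sum_typeProb hk hz
  obtain ⟨k, rfl⟩ := Nat.exists_eq_add_of_le' hk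
  -- A nonpositive gain can be chosen only in first position, when no gain is positive. Then `a 0 +
  -- a 1 ≥ 0` and `z 1 ≤ z 0` keep `z 0` from being very negative.
  have hpz : ∀ j, typeProb z j ≠ 0 → -(2 * d) ≤ z j := by
    intro j hj
    by_cases hpos : 0 < z j
    · linarith
    have hL := (succ_le_lastPositive_iff hz j).not.2 hpos
    rcases (by omega : lastPositive z ≤ 1 ∨ lastPositive z = 2 ∨ 3 ≤ lastPositive z) with h | h | h
    · rw [typeProb_of_lastPositive_le_one h] at hj
      have hj0 : j = 0 := by
        by_contra h'
        exact hj (if_neg fun h'' => h' (Fin.ext h''))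
      subst hj0
      have h1 := hz (Fin.zero_le 1)
      have h2 := ha 0 1 (by simp)
      have h3 := haz 0
      have h4 := haz 1
      linarith
    · rw [typeProb_of_lastPositive_eq_two h] at hj
      have h0 : j ≠ 0 := by rintro rfl; simp [h] at hL
      have h1 : j ≠ 1 := by rintro rfl; simp [h] at hL
      simp [h0, h1] at hj
    · rw [typeProb_of_three_le_lastPositive h, if_neg (by omega), if_neg (by omega)] at hj
      exact absurd rfl hj
  have hlow : -(2 * d) ≤ ∑ j, typeProb z j * z j := by
    calc -(2 * d) = ∑ j, typeProb z j * (-(2 * d)) := by rw [← Finset.sum_mul, hs, one_mul]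
      _ ≤ _ := by
        apply Finset.sum_le_sum
        intro j _
        by_cases h : typeProb z j = 0
        · simp [h]
        · exact mul_le_mul_of_nonneg_left (hpz j h) (hp j)
  -- If `z t ≤ 0`, then `a t ≤ d` and each difference is at most `2 * a t ≤ 2 * d`. Together with
  -- `hlow` this uses up the whole `4 * d`.
  by_cases hzt : 0 < z t
  swap
  · have : ∑ j, typeProb z j * (a t - a j) ≤ ∑ j, typeProb z j * (2 * d) := by
      apply Finset.sum_le_sum
      intro j _
      apply mul_le_mul_of_nonneg_left _ (hp j)
      by_cases hj : j = t
      · simp [hj, hd]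
      · have := ha j t hj
        have := haz t
        linarith
    rw [← Finset.sum_mul, hs] at this
    linarith
  have htL := (succ_le_lastPositive_iff hz t).2 hzt
  rcases (by omega : lastPositive z ≤ 1 ∨ lastPositive z = 2 ∨ 3 ≤ lastPositive z) with h | h | h
  · have ht0 : t = 0 := Fin.ext (by rw [Fin.val_zero]; omega)
    have : ∑ j, typeProb z j * (a t - a j) = 0 := by
      apply Finset.sum_eq_zero
      intro j _
      rw [typeProb_of_lastPositive_le_one h]
      split_ifs with hj
      · rw [ht0, Fin.ext (b := (0 : Fin (k + 2))) hj]
        simp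
      · simp
    linarith
  · have h0 : 0 < z 0 := (succ_le_lastPositive_iff hz 0).1 (by simp [h])
    have h1 : 0 < z 1 := (succ_le_lastPositive_iff hz 1).1 (by simp [h])
    have hsum : ∀ g : Fin (k + 2) → ℝ, ∑ j, typeProb z j * g j =
        z 0 / (z 0 + z 1) * g 0 + z 1 / (z 0 + z 1) * g 1 := by
      intro g
      rw [Finset.sum_eq_add_of_mem 0 1 (by simp) (by simp) (by simp)]
      · simp [typeProb_of_lastPositive_eq_two h]
      · rintro c - ⟨hc0, hc1⟩
        simp [typeProb_of_lastPositive_eq_two h, hc0, hc1]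
    rw [hsum, hsum]
    have h01 := ha 0 1 (by simp)
    have a0 := haz 0
    have a1 := haz 1
    have ht : t = 0 ∨ t = 1 := by
      simp only [Fin.ext_iff, Fin.val_zero, Fin.val_one]
      omega
    have hpos : 0 < z 0 + z 1 := by linarith
    -- With two positive gains only one difference survives, at most twice `z t + d`. After clearing
    -- the denominator the claim is `2 * z 0 * z 1 ≤ z 0 ^ 2 + z 1 ^ 2` plus error terms.
    rw [← sub_nonneg]
    have e : ∀ x0 x1 : ℝ, z 0 / (z 0 + z 1) * z 0 + z 1 / (z 0 + z 1) * z 1 + 4 * d -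
        (z 0 / (z 0 + z 1) * x0 + z 1 / (z 0 + z 1) * x1) =
        (z 0 ^ 2 + z 1 ^ 2 + 4 * d * (z 0 + z 1) - z 0 * x0 - z 1 * x1) / (z 0 + z 1) := by
      intro x0 x1
      field_simp
      ring
    rw [e]
    apply div_nonneg _ hpos.le
    rcases ht with rfl | rfl
    · have : z 1 * (a 0 - a 1) ≤ z 1 * (2 * (z 0 + d)) :=
        mul_le_mul_of_nonneg_left (by linarith) h1.le
      nlinarith [sq_nonneg (z 0 - z 1), mul_nonneg hd h0.le, mul_nonneg hd h1.le]
    · have : z 0 * (a 1 - a 0) ≤ z 0 * (2 * (z 1 + d)) :=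
        mul_le_mul_of_nonneg_left (by linarith) h0.le
      nlinarith [sq_nonneg (z 0 - z 1), mul_nonneg hd h0.le, mul_nonneg hd h1.le]
  · have hpow : ∀ i : ℕ, 2 ≤ i → (1 / 2 : ℝ) ^ i ≤ 1 / 4 := by
      intro i hi
      calc (1 / 2 : ℝ) ^ i ≤ (1 / 2 : ℝ) ^ 2 :=
            pow_le_pow_of_le_one (by norm_num) (by norm_num) hi
        _ = 1 / 4 := by norm_num
    have hhalf : ∀ j, typeProb z j ≤ 1 / 2 := by
      intro j
      rw [typeProb_of_three_le_lastPositive h]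
      split_ifs
      · linarith [hpow (lastPositive z - 1) (by omega)]
      · rw [pow_succ]
        have : (1 / 2 : ℝ) ^ (j : ℕ) ≤ 1 := pow_le_one₀ (by norm_num) (by norm_num)
        linarith
      · norm_num
    have hthird : ∀ i j, i < j → typeProb z j ≤ 1 / 3 := by
      intro i j hij
      have hj : 1 ≤ (j : ℕ) := by have := Fin.lt_def.1 hij; omega
      rw [typeProb_of_three_le_lastPositive h]
      split_ifs
      · linarith [hpow (lastPositive z - 1) (by omega)]
      · linarith [hpow (j + 1) (by omega)]
      · norm_num
    -- The weights before `t` add up to `1 - 2^(-t)`, and the weight of `t` is at least half of the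
    -- remaining `2^(-t)`.
    have ht : 1 ≤ ∑ j ∈ Finset.Iio t, typeProb z j + 2 * typeProb z t := by
      have hsum : ∑ j ∈ Finset.Iio t, typeProb z j = 1 - (1 / 2 : ℝ) ^ (t : ℕ) := by
        rw [← sum_range_half_pow]
        refine Finset.sum_bij (fun (j : Fin (k + 2)) _ => (j : ℕ)) ?_ ?_ ?_ ?_
        · intro j hj
          simpa using hj
        · intro i _ j _ hij
          exact Fin.ext hij
        · intro i hi
          have := Finset.mem_range.1 hi
          exact ⟨⟨i, by omega⟩, by simpa [Fin.lt_def] using this, rfl⟩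
        · intro j hj
          have : (j : ℕ) < t := by simpa using hj
          rw [typeProb_of_three_le_lastPositive h, if_neg (by omega), if_pos (by omega)]
      rw [hsum, typeProb_of_three_le_lastPositive h]
      split_ifs with h1 h2
      · rw [← h1]
        simp
        have : (0 : ℝ) ≤ (2 ^ (t : ℕ))⁻¹ := by positivity
        linarith
      · rw [pow_succ]
        linarith
      · omega
    have := sum_exchange_le_of_weights (y := fun j => z j + d) hk hp hs hhalf hthird ht haz
      (fun i j hij => by simpa using hz hij) (fun j hj => ?_) ha
    · have e : ∑ j, typeProb z j * (z j + d) = ∑ j, typeProb z j * z j + d := by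
        simp_rw [mul_add]
        rw [Finset.sum_add_distrib, ← Finset.sum_mul, hs, one_mul]
      rw [e] at this
      linarith
    · rw [typeProb_of_three_le_lastPositive h] at hj
      have : (j : ℕ) + 1 ≤ lastPositive z := by
        by_contra h'
        rw [if_neg (by omega), if_neg (by omega)] at hj
        exact hj rfl
      have := (succ_le_lastPositive_iff hz j).1 this
      linarith

end TypeProb

/-! ### The output and the number of queries of an oracle algorithm -/

section Output

variable {D : Type}

/-- The final output of the offline algorithm when it is run by C-ETC. -/
noncomputable def cetcOutput (m : ℕ) : OracleAlg D → (ℕ → D → ℝ) → D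
  | .output S, _ => S
  | .query A cont, r =>
      cetcOutput m (cont ((∑ i ∈ Finset.range m, r i A) / m)) fun i => r (m + i)

/-- The algorithm stops after exactly `N` queries, whatever the answers are. -/
inductive OracleAlg.HasQueryCount : ℕ → OracleAlg D → Prop
  | output (S : D) : OracleAlg.HasQueryCount 0 (.output S)
  | query {N : ℕ} (A : D) (cont : ℝ → OracleAlg D)
      (h : ∀ v, OracleAlg.HasQueryCount N (cont v)) : OracleAlg.HasQueryCount (N + 1) (.query A cont)

theorem cetcAction_eq_cetcOutput {m N : ℕ} {a : OracleAlg D} (h : a.HasQueryCount N)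
    (r : ℕ → D → ℝ) {t : ℕ} (ht : N * m ≤ t) : cetcAction m a r t = cetcOutput m a r := by
  induction h generalizing r t with
  | output S => rfl
  | @query N A cont _ ih =>
    rw [Nat.succ_mul] at ht
    rw [cetcAction, cetcOutput, if_neg (by omega)]
    exact ih _ _ (by omega)

/-- The output sees only exploration rewards; this makes it independent of every later reward. -/
theorem cetcOutput_congr {m N : ℕ} {a : OracleAlg D} (h : a.HasQueryCount N)
    {r r' : ℕ → D → ℝ} (hr : ∀ i < N * m, r i = r' i) : cetcOutput m a r = cetcOutput m a r' := by
  induction h generalizing r r' with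
  | output S => rfl
  | @query N A cont _ ih =>
    rw [Nat.succ_mul] at hr
    rw [cetcOutput, cetcOutput]
    have : ∑ i ∈ Finset.range m, r i A = ∑ i ∈ Finset.range m, r' i A :=
      Finset.sum_congr rfl fun i hi => by
        rw [hr i (by have := Finset.mem_range.1 hi; omega)]
    rw [this]
    exact ih _ fun i hi => hr _ (by omega)

end Output

/-! ### Measurability of oracle algorithms -/

section Measurability

variable {D : Type} [MeasurableSpace D]

/-- The actions played by C-ETC depend measurably on the parameter of the family of algorithms and
on the rewards. -/
def MeasurableFamily {Θ : Type} [MeasurableSpace Θ] (a : Θ → OracleAlg D) : Prop :=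
  ∀ m t, Measurable fun p : Θ × (ℕ → D → ℝ) => cetcAction m (a p.1) p.2 t

variable {Θ Θ' : Type} [MeasurableSpace Θ] [MeasurableSpace Θ']

theorem MeasurableFamily.comp {a : Θ → OracleAlg D} (ha : MeasurableFamily a) {g : Θ' → Θ}
    (hg : Measurable g) : MeasurableFamily fun θ => a (g θ) := fun m t =>
  (ha m t).comp (f := fun p : Θ' × (ℕ → D → ℝ) => (g p.1, p.2)) (by fun_prop)

theorem measurableFamily_output {S : Θ → D} (hS : Measurable S) :
    MeasurableFamily fun θ => OracleAlg.output (S θ) := fun _ _ => hS.comp measurable_fst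

/-- The answer becomes an additional real parameter of the continuation. Countability of `D` makes
evaluation of a reward function at a random action jointly measurable. -/
theorem measurableFamily_query [Countable D] [MeasurableSingletonClass D] {A : Θ → D}
    (hA : Measurable A) {cont : Θ → ℝ → OracleAlg D}
    (hcont : MeasurableFamily fun q : Θ × ℝ => cont q.1 q.2) :
    MeasurableFamily fun θ => OracleAlg.query (A θ) (cont θ) := by
  intro m t
  simp only [cetcAction]
  split_ifs
  · exact hA.comp measurable_fst
  · have heval : Measurable fun q : (D → ℝ) × D => q.1 q.2 :=
      measurable_from_prod_countable_left fun y => measurable_pi_apply y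
    have hmean : Measurable fun p : Θ × (ℕ → D → ℝ) =>
        (∑ i ∈ Finset.range m, p.2 i (A p.1)) / m := by
      refine Measurable.div_const (Finset.measurable_fun_sum _ fun i _ => ?_) _
      exact heval.comp (Measurable.prodMk (by fun_prop) (by fun_prop))
    have hshift : Measurable fun p : Θ × (ℕ → D → ℝ) => fun i => p.2 (m + i) := by
      refine measurable_pi_lambda _ fun i => ?_
      fun_prop
    exact (hcont m (t - m)).comp ((measurable_fst.prodMk hmean).prodMk hshift)

/-- The output is the action of round `N * m`, so it inherits measurability from the actions. -/
theorem MeasurableFamily.measurable_cetcOutput {a : Θ → OracleAlg D} (ha : MeasurableFamily a)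
    {N : ℕ} (hN : ∀ θ, (a θ).HasQueryCount N) (m : ℕ) :
    Measurable fun p : Θ × (ℕ → D → ℝ) => cetcOutput m (a p.1) p.2 := by
  have := ha m (N * m)
  rwa [show (fun p : Θ × (ℕ → D → ℝ) => cetcAction m (a p.1) p.2 (N * m)) =
    fun p => cetcOutput m (a p.1) p.2 from
      funext fun p => cetcAction_eq_cetcOutput (hN p.1) p.2 le_rfl] at this

end Measurability

/-! ### Sampling -/

section Sampling

variable {k : ℕ}

instance instMeasurableSpaceOptionFin : MeasurableSpace (Option (Fin k)) := ⊤

instance instDiscreteMeasurableSpaceOptionFin : DiscreteMeasurableSpace (Option (Fin k)) :=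
  ⟨fun _ => trivial⟩

theorem sampleIndex_eq_some_iff {p : Fin k → ℝ} {u : ℝ} {j : Fin k} :
    sampleIndex p u = some j ↔
      u < ∑ l ∈ Finset.Iic j, p l ∧ ∀ i < j, ∑ l ∈ Finset.Iic i, p l ≤ u := by
  classical
  unfold sampleIndex
  rw [List.find?_eq_some_iff_getElem]
  simp only [decide_eq_true_eq, List.getElem_finRange, Bool.not_eq_true', decide_eq_false_iff_not,
    not_lt, List.length_finRange]
  refine and_congr_right fun _ => ⟨?_, fun h => ⟨j, j.2, by simp, fun i hi => ?_⟩⟩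
  · rintro ⟨i, hi, rfl, h⟩ l hl
    have := h l (by simpa [Fin.lt_def] using hl)
    simpa using this
  · exact h _ (by simpa [Fin.lt_def] using hi)

theorem sampleIndex_eq_none_iff {p : Fin k → ℝ} {u : ℝ} :
    sampleIndex p u = none ↔ ∀ i, ∑ l ∈ Finset.Iic i, p l ≤ u := by
  classical
  unfold sampleIndex
  rw [List.find?_eq_none]
  simp

theorem measurable_sampleIndex :
    Measurable fun q : (Fin k → ℝ) × ℝ => sampleIndex q.1 q.2 := by
  have hC : ∀ i : Fin k, Measurable fun q : (Fin k → ℝ) × ℝ => ∑ l ∈ Finset.Iic i, q.1 l :=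
    fun i => Finset.measurable_fun_sum _ fun l _ => by fun_prop
  refine measurable_to_countable' fun o => ?_
  cases o with
  | none =>
    have : (fun q : (Fin k → ℝ) × ℝ => sampleIndex q.1 q.2) ⁻¹' {none} =
        ⋂ i, {q | ∑ l ∈ Finset.Iic i, q.1 l ≤ q.2} := by
      ext q
      simp [sampleIndex_eq_none_iff]
    rw [this]
    exact MeasurableSet.iInter fun i => measurableSet_le (hC i) measurable_snd
  | some j =>
    have : (fun q : (Fin k → ℝ) × ℝ => sampleIndex q.1 q.2) ⁻¹' {some j} =
        {q | q.2 < ∑ l ∈ Finset.Iic j, q.1 l} ∩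
          ⋂ i, ⋂ (_ : i < j), {q | ∑ l ∈ Finset.Iic i, q.1 l ≤ q.2} := by
      ext q
      simp [sampleIndex_eq_some_iff]
    rw [this]
    exact (measurableSet_lt measurable_snd (hC j)).inter (MeasurableSet.iInter fun i =>
      MeasurableSet.iInter fun _ => measurableSet_le (hC i) measurable_snd)

/-- Sampling from a probability vector yields each index with its probability. -/
theorem volume_sampleIndex_eq_some {p : Fin k → ℝ} (hp : ∀ j, 0 ≤ p j) (hs : ∑ j, p j = 1)
    (j : Fin k) :
    (volume.restrict (Set.Icc (0 : ℝ) 1)).real {u | sampleIndex p u = some j} = p j := by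
  have hIio : ∀ i : Fin k, ∑ l ∈ Finset.Iic i, p l = ∑ l ∈ Finset.Iio i, p l + p i := by
    intro i
    rw [← Finset.Iio_insert, Finset.sum_insert (by simp), add_comm]
  have hle1 : ∑ l ∈ Finset.Iic j, p l ≤ 1 := by
    rw [← hs]
    exact Finset.sum_le_sum_of_subset_of_nonneg (Finset.subset_univ _) fun l _ _ => hp l
  have hle0 : 0 ≤ ∑ l ∈ Finset.Iio j, p l := Finset.sum_nonneg fun l _ => hp l
  have hmono : ∀ i < j, ∑ l ∈ Finset.Iic i, p l ≤ ∑ l ∈ Finset.Iio j, p l := fun i hi =>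
    Finset.sum_le_sum_of_subset_of_nonneg
      (fun l hl => Finset.mem_Iio.2 ((Finset.mem_Iic.1 hl).trans_lt hi)) fun l _ _ => hp l
  -- The seeds selecting `j` form the interval between consecutive partial sums, of length `p j`.
  have hset : {u | sampleIndex p u = some j} ∩ Set.Icc (0 : ℝ) 1 =
      Set.Ico (∑ l ∈ Finset.Iio j, p l) (∑ l ∈ Finset.Iic j, p l) := by
    ext u
    simp only [Set.mem_inter_iff, Set.mem_ofPred_eq, sampleIndex_eq_some_iff, Set.mem_Icc,
      Set.mem_Ico]
    constructor
    · rintro ⟨⟨h1, h2⟩, h0, -⟩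
      refine ⟨?_, h1⟩
      rcases Nat.eq_zero_or_pos (j : ℕ) with hj | hj
      · have : Finset.Iio j = ∅ := by
          ext l
          simp only [Finset.mem_Iio, Fin.lt_def, Finset.notMem_empty, iff_false]
          omega
        simpa [this] using h0
      · have := h2 ⟨j - 1, by omega⟩ (by simp [Fin.lt_def]; omega)
        refine le_trans (le_of_eq ?_) this
        apply Finset.sum_congr _ fun _ _ => rfl
        ext l
        simp only [Finset.mem_Iio, Finset.mem_Iic, Fin.lt_def, Fin.le_def]
        omega
    · rintro ⟨h1, h2⟩
      exact ⟨⟨h2, fun i hi => (hmono i hi).trans h1⟩, hle0.trans h1, h2.le.trans hle1⟩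
  have hmeas : MeasurableSet {u | sampleIndex p u = some j} :=
    (measurable_sampleIndex.comp (measurable_const.prodMk measurable_id))
      (measurableSet_singleton (some j))
  rw [measureReal_restrict_apply hmeas, hset, Measure.real, Real.volume_Ico, hIio,
    add_sub_cancel_left, ENNReal.toReal_ofReal (hp j)]

theorem integral_sampleIndex {p : Fin k → ℝ} (hp : ∀ j, 0 ≤ p j) (hs : ∑ j, p j = 1)
    (φ : Option (Fin k) → ℝ) :
    ∫ u in Set.Icc (0 : ℝ) 1, φ (sampleIndex p u) = ∑ j, p j * φ (some j) := by
  have hmeas : Measurable (sampleIndex p) :=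
    measurable_sampleIndex.comp (measurable_const.prodMk measurable_id)
  have hprob : IsProbabilityMeasure (volume.restrict (Set.Icc (0 : ℝ) 1)) := ⟨by simp⟩
  have hmap : IsProbabilityMeasure ((volume.restrict (Set.Icc (0 : ℝ) 1)).map (sampleIndex p)) :=
    Measure.isProbabilityMeasure_map hmeas.aemeasurable
  rw [← integral_map hmeas.aemeasurable (f := φ)
    (Measurable.of_discrete).aestronglyMeasurable]
  rw [integral_fintype (.of_finite), Fintype.sum_option]
  have hsome : ∀ j, ((volume.restrict (Set.Icc (0 : ℝ) 1)).map (sampleIndex p)).real {some j} =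
      p j := by
    intro j
    rw [map_measureReal_apply hmeas (measurableSet_singleton _)]
    exact volume_sampleIndex_eq_some hp hs j
  -- The indices already carry total mass 1, so nothing is left for `none`.
  have hnone : ((volume.restrict (Set.Icc (0 : ℝ) 1)).map (sampleIndex p)).real {none} = 0 := by
    have h1 := integral_fintype (μ := (volume.restrict (Set.Icc (0 : ℝ) 1)).map (sampleIndex p))
      (f := fun _ => (1 : ℝ)) (.of_finite)
    rw [Fintype.sum_option] at h1
    simp only [hsome, smul_eq_mul, mul_one, hs, integral_const, probReal_univ] at h1
    linarith
  simp [hsome, hnone]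

end Sampling

/-! ### The main loop of the randomized algorithm -/

section Loop

variable {n k : ℕ}

theorem measurable_lastPositive : Measurable (lastPositive (k := k)) := by
  refine measurable_of_Iic fun N => ?_
  have : (lastPositive (k := k)) ⁻¹' Set.Iic N =
      ⋂ j : Fin k, {z | 0 < z j → (j : ℕ) + 1 ≤ N} := by
    ext z
    simp [lastPositive]
  rw [this]
  refine MeasurableSet.iInter fun j => ?_
  by_cases h : (j : ℕ) + 1 ≤ N
  · simp [h]
  · simp only [h, imp_false, not_lt]
    exact measurableSet_le (measurable_pi_apply j) measurable_const

theorem measurable_typeProb : Measurable (typeProb (k := k)) := by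
  refine measurable_pi_lambda _ fun j => ?_
  unfold typeProb
  have hL := measurable_lastPositive (k := k)
  refine Measurable.ite (hL measurableSet_Iic) measurable_const (Measurable.ite
    (hL (measurableSet_singleton 2)) (Measurable.ite (.const _) ?_ measurable_const)
    (Measurable.ite (hL (measurableSet_singleton ((j : ℕ) + 1)) |> fun h => ?_) ?_
      (Measurable.ite (hL (measurableSet_Ioi (a := (j : ℕ) + 1))) measurable_const
        measurable_const)))
  · exact (measurable_pi_apply j).div (Finset.measurable_fun_sum _ fun l _ => measurable_pi_apply l)
  · simpa [Set.preimage, eq_comm] using h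
  · exact (Measurable.of_discrete (f := fun N : ℕ => (1 / 2 : ℝ) ^ (N - 1))).comp hL

variable (σ : (Fin k → ℝ) → Equiv.Perm (Fin k))

/-- The new solution and its known value when the type `o` has been sampled from the types
permuted by `π`. -/
def updateState (e : Fin n) (o : Option (Fin k)) (π : Equiv.Perm (Fin k))
    (s : Assignment n k) (v : ℝ) (w : Fin k → ℝ) : Assignment n k × ℝ :=
  match o with
  | none => (s, v)
  | some j => (Assignment.assign s e (π j), w (π j))

/-- The next state of the main loop, given the answers `w` and the seed `u`. -/
noncomputable def nextState (e : Fin n) (s : Assignment n k) (v : ℝ) (w : Fin k → ℝ) (u : ℝ) :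
    Assignment n k × ℝ :=
  updateState e (sampleIndex (typeProb fun j => w (σ (fun i => w i - v) j) - v) u)
    (σ fun i => w i - v) s v w

/-- The answers recorded by `queryTypes`. -/
noncomputable def queryAnswers (m : ℕ) (s : Assignment n k) (e : Fin n) :
    List (Fin k) → (Fin k → ℝ) → (ℕ → Assignment n k → ℝ) → Fin k → ℝ
  | [], w, _ => w
  | i :: l, w, r =>
      queryAnswers m s e l
        (Function.update w i ((∑ j ∈ Finset.range m, r j (Assignment.assign s e i)) / m))
        fun j => r (m + j)

theorem cetcOutput_queryTypes (m : ℕ) (s : Assignment n k) (e : Fin n) (l : List (Fin k))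
    (w : Fin k → ℝ) (cont : (Fin k → ℝ) → OracleAlg (Assignment n k))
    (r : ℕ → Assignment n k → ℝ) :
    cetcOutput m (queryTypes s e l w cont) r =
      cetcOutput m (cont (queryAnswers m s e l w r)) fun i => r (l.length * m + i) := by
  induction l generalizing w r with
  | nil => simp [queryTypes, queryAnswers]
  | cons i l ih =>
    rw [queryTypes, cetcOutput, ih, queryAnswers]
    congr 1
    funext j
    rw [List.length_cons]
    congr 1
    ring

theorem queryAnswers_of_notMem (m : ℕ) (s : Assignment n k) (e : Fin n) {l : List (Fin k)}
    (w : Fin k → ℝ) (r : ℕ → Assignment n k → ℝ) {i : Fin k} (hi : i ∉ l) :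
    queryAnswers m s e l w r i = w i := by
  induction l generalizing w r with
  | nil => rfl
  | cons a l ih =>
    rw [List.mem_cons, not_or] at hi
    rw [queryAnswers, ih _ _ hi.2, Function.update_of_ne hi.1]

/-- The query at position `q` occupies the `q`-th block of `m` rounds, and without repetitions in
the list no later query overwrites its answer. -/
theorem queryAnswers_getElem (m : ℕ) (s : Assignment n k) (e : Fin n) {l : List (Fin k)}
    (hl : l.Nodup) (w : Fin k → ℝ) (r : ℕ → Assignment n k → ℝ) (q : ℕ) (hq : q < l.length) :
    queryAnswers m s e l w r l[q] =
      (∑ j ∈ Finset.range m, r (q * m + j) (Assignment.assign s e l[q])) / m := by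
  induction l generalizing w r q with
  | nil => simp at hq
  | cons a l ih =>
    rw [List.nodup_cons] at hl
    rw [queryAnswers]
    cases q with
    | zero => simp [queryAnswers_of_notMem m s e _ _ hl.1]
    | succ q =>
      simp only [List.getElem_cons_succ]
      rw [ih hl.2 _ _ q (by simpa using hq)]
      simp only [add_mul, one_mul]
      congr 1
      refine Finset.sum_congr rfl fun j _ => ?_
      congr 1
      ring

/-- The empirical means of the rewards of the `k` actions queried for the element `e`. -/
noncomputable def blockMeans (m : ℕ) (s : Assignment n k) (e : Fin n) (r : ℕ → Assignment n k → ℝ) (i : Fin k) :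
    ℝ :=
  (∑ j ∈ Finset.range m, r (i * m + j) (Assignment.assign s e i)) / m

theorem queryAnswers_finRange (m : ℕ) (s : Assignment n k) (e : Fin n)
    (w : Fin k → ℝ) (r : ℕ → Assignment n k → ℝ) :
    queryAnswers m s e (List.finRange k) w r = blockMeans m s e r := by
  funext i
  have := queryAnswers_getElem m s e (List.nodup_finRange k) w r i (by simp)
  simpa [blockMeans] using this

theorem randomizedLoop_cons (u : Fin n → ℝ) (e : Fin n) (es : List (Fin n)) (s : Assignment n k)
    (v : ℝ) :
    randomizedLoop σ u (e :: es) s v = queryTypes s e (List.finRange k) 0 fun w =>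
      randomizedLoop σ u es (nextState σ e s v w (u e)).1 (nextState σ e s v w (u e)).2 := by
  rw [randomizedLoop]
  congr 1
  funext w
  simp only [nextState]
  cases sampleIndex (typeProb fun j => w (σ (fun i => w i - v) j) - v) (u e) <;> rfl

theorem cetcOutput_randomizedLoop_cons (m : ℕ) (u : Fin n → ℝ) (e : Fin n) (es : List (Fin n))
    (s : Assignment n k) (v : ℝ) (r : ℕ → Assignment n k → ℝ) :
    cetcOutput m (randomizedLoop σ u (e :: es) s v) r =
      cetcOutput m (randomizedLoop σ u es (nextState σ e s v (blockMeans m s e r) (u e)).1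
        (nextState σ e s v (blockMeans m s e r) (u e)).2) fun i => r (k * m + i) := by
  rw [randomizedLoop_cons, cetcOutput_queryTypes, queryAnswers_finRange, List.length_finRange]

/-- Allows the seed of an element already treated to be erased, so that the rest of the run is
visibly independent of it. -/
theorem randomizedLoop_congr {u u' : Fin n → ℝ} {es : List (Fin n)} (h : ∀ e ∈ es, u e = u' e)
    (s : Assignment n k) (v : ℝ) : randomizedLoop σ u es s v = randomizedLoop σ u' es s v := by
  induction es generalizing s v with
  | nil => rfl
  | cons e es ih =>
    rw [randomizedLoop_cons, randomizedLoop_cons, h e (by simp)]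
    congr 1
    funext w
    exact ih (fun e' he' => h e' (by simp [he'])) _ _

theorem hasQueryCount_queryTypes {N : ℕ} (s : Assignment n k) (e : Fin n) (l : List (Fin k))
    (w : Fin k → ℝ) {cont : (Fin k → ℝ) → OracleAlg (Assignment n k)}
    (h : ∀ w, (cont w).HasQueryCount N) :
    (queryTypes s e l w cont).HasQueryCount (N + l.length) := by
  induction l generalizing w with
  | nil => exact h w
  | cons i l ih => exact .query _ _ fun v => ih _

theorem hasQueryCount_randomizedLoop (u : Fin n → ℝ) (es : List (Fin n)) (s : Assignment n k)
    (v : ℝ) : (randomizedLoop σ u es s v).HasQueryCount (es.length * k) := by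
  induction es generalizing s v with
  | nil => simpa [randomizedLoop] using OracleAlg.HasQueryCount.output s
  | cons e es ih =>
    rw [randomizedLoop_cons, List.length_cons, Nat.succ_mul]
    have := hasQueryCount_queryTypes s e (List.finRange k) 0 (cont := fun w =>
      randomizedLoop σ u es (nextState σ e s v w (u e)).1 (nextState σ e s v w (u e)).2)
      fun w => ih _ _
    rwa [List.length_finRange] at this

theorem hasQueryCount_randomizedKSubmodularMax (b : Bool) (ord : Equiv.Perm (Fin n))
    (u : Fin n → ℝ) :
    (randomizedKSubmodularMax b ord σ u).HasQueryCount (n * k + if b then 1 else 0) := by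
  have h := fun v => hasQueryCount_randomizedLoop σ u ((List.finRange n).map ord)
    (Assignment.empty n k) v
  simp only [List.length_map, List.length_finRange] at h
  cases b
  · simpa [randomizedKSubmodularMax] using h 0
  · simpa [randomizedKSubmodularMax] using OracleAlg.HasQueryCount.query _ _ h

theorem measurable_assign (e : Fin n) (i : Fin k) :
    Measurable fun s : Assignment n k => Assignment.assign s e i := Measurable.of_discrete

variable {σ}

/-- There are finitely many sampled types and sorting permutations. Both depend measurably on the
data, and for fixed values of both the update is measurable. -/
theorem measurable_nextState (hσ : ∀ π, MeasurableSet {y | σ y = π}) (e : Fin n) :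
    Measurable fun q : (Assignment n k × ℝ) × (Fin k → ℝ) × ℝ =>
      nextState σ e q.1.1 q.1.2 q.2.1 q.2.2 := by
  let _ : MeasurableSpace (Equiv.Perm (Fin k)) := ⊤
  have _ : DiscreteMeasurableSpace (Equiv.Perm (Fin k)) := ⟨fun _ => trivial⟩
  have hσ' : Measurable σ := measurable_to_countable' fun π => hσ π
  have hy : Measurable fun q : (Assignment n k × ℝ) × (Fin k → ℝ) × ℝ =>
      fun i => q.2.1 i - q.1.2 := by fun_prop
  have hπ := hσ'.comp hy
  have hz : Measurable fun q : (Assignment n k × ℝ) × (Fin k → ℝ) × ℝ =>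
      fun j => q.2.1 (σ (fun i => q.2.1 i - q.1.2) j) - q.1.2 := by
    have h : Measurable fun q : ((Fin k → ℝ) × ℝ) × Equiv.Perm (Fin k) =>
        fun j => q.1.1 (q.2 j) - q.1.2 :=
      measurable_from_prod_countable_left fun π => measurable_pi_lambda _ fun j =>
        ((measurable_pi_apply (π j)).comp measurable_fst).sub measurable_snd
    exact h.comp (((measurable_fst.comp measurable_snd).prodMk
      (measurable_snd.comp measurable_fst)).prodMk hπ)
  have ho : Measurable fun q : (Assignment n k × ℝ) × (Fin k → ℝ) × ℝ =>
      sampleIndex (typeProb fun j => q.2.1 (σ (fun i => q.2.1 i - q.1.2) j) - q.1.2) q.2.2 :=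
    measurable_sampleIndex.comp ((measurable_typeProb.comp hz).prodMk
      (measurable_snd.comp measurable_snd))
  have hG : Measurable fun q : ((Assignment n k × ℝ) × (Fin k → ℝ) × ℝ) ×
      (Option (Fin k) × Equiv.Perm (Fin k)) =>
      updateState e q.2.1 q.2.2 q.1.1.1 q.1.1.2 q.1.2.1 := by
    refine measurable_from_prod_countable_left ?_
    rintro ⟨o, π⟩
    cases o with
    | none => exact measurable_fst
    | some j =>
      exact ((measurable_assign e (π j)).comp (measurable_fst.comp measurable_fst)).prodMk
        ((measurable_pi_apply (π j)).comp (measurable_fst.comp measurable_snd))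
  exact hG.comp (measurable_id.prodMk (ho.prodMk hπ))

theorem measurableFamily_queryTypes (e : Fin n) (l : List (Fin k)) :
    ∀ {Θ : Type} [MeasurableSpace Θ] {s : Θ → Assignment n k} {w : Θ → Fin k → ℝ}
      {cont : Θ → (Fin k → ℝ) → OracleAlg (Assignment n k)}, Measurable s → Measurable w →
      (MeasurableFamily fun q : Θ × (Fin k → ℝ) => cont q.1 q.2) →
      MeasurableFamily fun θ => queryTypes (s θ) e l (w θ) (cont θ) := by
  induction l with
  | nil =>
    intro Θ _ s w cont _ hw hcont
    exact hcont.comp (measurable_id.prodMk hw)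
  | cons i l ih =>
    intro Θ _ s w cont hs hw hcont
    refine measurableFamily_query ((measurable_assign e i).comp hs) ?_
    refine ih (Θ := Θ × ℝ) (s := fun q => s q.1) (w := fun q => Function.update (w q.1) i q.2)
      (cont := fun q => cont q.1) (hs.comp measurable_fst) ?_ ?_
    · exact measurable_update'.comp ((hw.comp measurable_fst).prodMk measurable_snd)
    · exact hcont.comp (g := fun q : (Θ × ℝ) × (Fin k → ℝ) => (q.1.1, q.2)) (by fun_prop)

theorem measurableFamily_randomizedLoop (hσ : ∀ π, MeasurableSet {y | σ y = π})
    (es : List (Fin n)) :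
    MeasurableFamily fun θ : (Assignment n k × ℝ) × (Fin n → ℝ) =>
      randomizedLoop σ θ.2 es θ.1.1 θ.1.2 := by
  induction es with
  | nil => exact measurableFamily_output (measurable_fst.comp measurable_fst)
  | cons e es ih =>
    simp only [randomizedLoop_cons]
    refine measurableFamily_queryTypes e _ (measurable_fst.comp measurable_fst)
      measurable_const ?_
    refine ih.comp (g := fun q : ((Assignment n k × ℝ) × (Fin n → ℝ)) × (Fin k → ℝ) =>
      (nextState σ e q.1.1.1 q.1.1.2 q.2 (q.1.2 e), q.1.2)) ?_
    refine Measurable.prodMk ?_ (by fun_prop)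
    refine (measurable_nextState hσ e).comp
      (f := fun q : ((Assignment n k × ℝ) × (Fin n → ℝ)) × (Fin k → ℝ) =>
        ((q.1.1.1, q.1.1.2), (q.2, q.1.2 e))) ?_
    fun_prop

theorem measurableFamily_randomizedKSubmodularMax (hσ : ∀ π, MeasurableSet {y | σ y = π})
    (b : Bool) (ord : Equiv.Perm (Fin n)) :
    MeasurableFamily fun u : Fin n → ℝ => randomizedKSubmodularMax (k := k) b ord σ u := by
  have h := measurableFamily_randomizedLoop (n := n) hσ ((List.finRange n).map ord)
  cases b
  · exact h.comp (g := fun u : Fin n → ℝ => ((Assignment.empty n k, (0 : ℝ)), u)) (by fun_prop)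
  · refine measurableFamily_query (A := fun _ => Assignment.empty n k) measurable_const ?_
    exact h.comp (g := fun q : (Fin n → ℝ) × ℝ => ((Assignment.empty n k, q.2), q.1))
      (by fun_prop)

end Loop

/-! ### Independence -/

section Independence

variable {Ω : Type*} [MeasurableSpace Ω] {P : Measure Ω} [IsProbabilityMeasure P]

/-- Two independent pairs of random variables, each of which is independent in itself, can be
regrouped. -/
theorem indepFun_prodMk_prodMk_of_indepFun {α β γ δ : Type*} [MeasurableSpace α]
    [MeasurableSpace β] [MeasurableSpace γ] [MeasurableSpace δ] {A : Ω → α} {B : Ω → β}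
    {C : Ω → γ} {D : Ω → δ} (hA : Measurable A) (hB : Measurable B) (hC : Measurable C)
    (hD : Measurable D) (h : IndepFun (fun ω => (A ω, B ω)) (fun ω => (C ω, D ω)) P)
    (hAB : IndepFun A B P) (hCD : IndepFun C D P) :
    IndepFun (fun ω => (A ω, C ω)) (fun ω => (B ω, D ω)) P := by
  have hAC : IndepFun A C P := h.comp measurable_fst measurable_fst
  have hBD : IndepFun B D P := h.comp measurable_snd measurable_snd
  rw [IndepFun_iff_Indep]
  -- Rectangles form generating π-systems, and on them the hypotheses factor all probabilities
  -- completely.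
  refine IndepSets.indep (hA.prodMk hC).comap_le (hB.prodMk hD).comap_le
    (isPiSystem_prod.comap fun ω => (A ω, C ω)) (isPiSystem_prod.comap fun ω => (B ω, D ω))
    ?_ ?_ ?_
  · rw [← generateFrom_prod, MeasurableSpace.comap_generateFrom]
    rfl
  · rw [← generateFrom_prod, MeasurableSpace.comap_generateFrom]
    rfl
  · rw [IndepSets_iff]
    rintro _ _ ⟨_, ⟨s, hs, t, ht, rfl⟩, rfl⟩ ⟨_, ⟨s', hs', t', ht', rfl⟩, rfl⟩
    have h1 := h.measure_inter_preimage_eq_mul _ _ (hs.prod hs') (ht.prod ht')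
    have h2 := hAB.measure_inter_preimage_eq_mul _ _ hs hs'
    have h3 := hCD.measure_inter_preimage_eq_mul _ _ ht ht'
    have h4 := hAC.measure_inter_preimage_eq_mul _ _ hs ht
    have h5 := hBD.measure_inter_preimage_eq_mul _ _ hs' ht'
    simp only [Set.mk_preimage_prod] at h1 ⊢
    rw [Set.inter_inter_inter_comm, h1, h2, h3, h4, h5, mul_mul_mul_comm]

/-- A lower bound for the expectation of a function of two independent random variables. -/
theorem integral_le_integral_of_indepFun {α β : Type*} [MeasurableSpace α] [MeasurableSpace β]
    {X : Ω → α} {Z : Ω → β} (hX : Measurable X) (hZ : Measurable Z) (h : IndepFun X Z P)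
    {F : α × β → ℝ} (hF : Measurable F) (hFi : Integrable (fun ω => F (X ω, Z ω)) P)
    {G : α → ℝ} (hG : Measurable G) (hGi : Integrable (fun ω => G (X ω)) P)
    (hGF : ∀ x, G x ≤ ∫ ω, F (x, Z ω) ∂P) : ∫ ω, G (X ω) ∂P ≤ ∫ ω, F (X ω, Z ω) ∂P := by
  have hmap := (indepFun_iff_map_prod_eq_prod_map_map hX.aemeasurable hZ.aemeasurable).1 h
  have hXp := Measure.isProbabilityMeasure_map (μ := P) hX.aemeasurable
  have hZp := Measure.isProbabilityMeasure_map (μ := P) hZ.aemeasurable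
  have hFi' : Integrable F ((P.map X).prod (P.map Z)) := by
    rw [← hmap, integrable_map_measure hF.aestronglyMeasurable (hX.prodMk hZ).aemeasurable]
    exact hFi
  have hGi' : Integrable G (P.map X) :=
    (integrable_map_measure hG.aestronglyMeasurable hX.aemeasurable).2 hGi
  calc ∫ ω, G (X ω) ∂P = ∫ x, G x ∂(P.map X) :=
        (integral_map hX.aemeasurable hG.aestronglyMeasurable).symm
    _ ≤ ∫ x, ∫ z, F (x, z) ∂(P.map Z) ∂(P.map X) := by
        refine integral_mono hGi' hFi'.integral_prod_left fun x => ?_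
        refine (hGF x).trans_eq ?_
        exact (integral_map hZ.aemeasurable
          (hF.comp measurable_prodMk_left).aestronglyMeasurable).symm
    _ = ∫ p, F p ∂((P.map X).prod (P.map Z)) := (integral_prod _ hFi').symm
    _ = ∫ ω, F (X ω, Z ω) ∂P := by
        rw [← hmap, integral_map (hX.prodMk hZ).aemeasurable hF.aestronglyMeasurable]

end Independence

/-! ### Reward processes -/

section Rewards

variable {Ω D : Type*} [MeasurableSpace Ω] {P : Measure Ω}
  {r : ℕ → Ω → D → ℝ}

/-- Restarts the clock after a block of rounds, as needed by the induction over the elements. -/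
theorem IsStochasticReward.shift (hr : IsStochasticReward P r) (a : ℕ) :
    IsStochasticReward P fun i => r (a + i) where
  measurable _ := hr.measurable _
  indep := hr.indep.precomp (add_right_injective a)
  identDistrib _ A := (hr.identDistrib _ A).trans (hr.identDistrib (a + 0) A).symm
  bounded _ A := hr.bounded _ A

theorem IsStochasticReward.meanReward_shift (hr : IsStochasticReward P r) (a : ℕ) :
    meanReward P (fun i => r (a + i)) = meanReward P r :=
  funext fun A => (hr.identDistrib (a + 0) A).integral_eq

theorem IsStochasticReward.measurable_apply (hr : IsStochasticReward P r) (t : ℕ) (A : D) :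
    Measurable fun ω => r t ω A := measurable_pi_iff.1 (hr.measurable t) A

theorem IsStochasticReward.integral_eq (hr : IsStochasticReward P r) (t : ℕ) (A : D) :
    ∫ ω, r t ω A ∂P = meanReward P r A := (hr.identDistrib t A).integral_eq

theorem IsUniformSeed.shift {ι : Type*} {U : ι → Ω → ℝ} (hU : IsUniformSeed P r U) (a : ℕ) :
    IsUniformSeed P (fun i => r (a + i)) U where
  measurable := hU.measurable
  uniform := hU.uniform
  indep := hU.indep
  indep_rewards := hU.indep_rewards.comp (φ := fun ρ : ℕ → D → ℝ => fun i => ρ (a + i))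
    (ψ := id) (by fun_prop) measurable_id

/-- The empirical mean of the first `m` rewards of the action `A`. -/
noncomputable def empiricalMean (m : ℕ) (ρ : ℕ → D → ℝ) (A : D) : ℝ :=
  (∑ j ∈ Finset.range m, ρ j A) / m

theorem measurable_empiricalMean (m : ℕ) (A : D) :
    Measurable fun ρ : ℕ → D → ℝ => empiricalMean m ρ A := by
  unfold empiricalMean
  fun_prop

theorem IsStochasticReward.empiricalMean_mem_Icc (hr : IsStochasticReward P r) (m : ℕ) (A : D) :
    ∀ᵐ ω ∂P, empiricalMean m (fun i => r i ω) A ∈ Set.Icc (0 : ℝ) 1 := by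
  have := ae_all_iff.2 fun t => hr.bounded t A
  filter_upwards [this] with ω h
  constructor
  · exact div_nonneg (Finset.sum_nonneg fun j _ => (h j).1) (Nat.cast_nonneg m)
  · refine div_le_one_of_le₀ ?_ (Nat.cast_nonneg m)
    calc ∑ j ∈ Finset.range m, r j ω A ≤ ∑ j ∈ Finset.range m, (1 : ℝ) :=
          Finset.sum_le_sum fun j _ => (h j).2
      _ = m := by simp

theorem IsStochasticReward.measurable_empiricalMean_comp (hr : IsStochasticReward P r) (m : ℕ)
    (A : D) : Measurable fun ω => empiricalMean m (fun i => r i ω) A :=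
  (measurable_empiricalMean m A).comp (measurable_pi_lambda _ hr.measurable)

/-- The rewards of the first `a` rounds are independent of the rewards of the later rounds. -/
theorem IsStochasticReward.indepFun_past_future (hr : IsStochasticReward P r) (a : ℕ) :
    IndepFun (fun ω (i : Fin a) => r i ω) (fun ω i => r (a + i) ω) P := by
  rw [IndepFun_iff_Indep]
  have hdisj : Disjoint (Set.Iio a) (Set.Ici a) := by
    rw [Set.disjoint_left]
    intro i hi hi'
    exact absurd (Set.mem_Iio.1 hi) (not_lt.2 (Set.mem_Ici.1 hi'))
  refine indep_of_indep_of_le (indep_iSup_of_disjoint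
    (fun i => (hr.measurable i).comap_le) hr.indep.iIndep hdisj) ?_ ?_
  · refine Measurable.comap_le (@measurable_pi_lambda _ _ _ (_) _ _ fun i => ?_)
    exact (comap_measurable (r i)).mono
      (le_iSup₂ (f := fun i (_ : i ∈ Set.Iio a) => MeasurableSpace.comap (r i) MeasurableSpace.pi)
        (i : ℕ) i.2) le_rfl
  · refine Measurable.comap_le (@measurable_pi_lambda _ _ _ (_) _ _ fun i => ?_)
    exact (comap_measurable (r (a + i))).mono
      (le_iSup₂ (f := fun i (_ : i ∈ Set.Ici a) => MeasurableSpace.comap (r i) MeasurableSpace.pi)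
        (a + i) (Nat.le_add_right a i)) le_rfl

/-- The remaining seeds are encoded by a zero at `e`, which keeps them a function on all of `Fin n`.
-/
theorem IsUniformSeed.indepFun_update {n : ℕ} {U : Fin n → Ω → ℝ} (hU : IsUniformSeed P r U)
    (e : Fin n) :
    IndepFun (U e) (fun ω => Function.update (fun e => U e ω) e 0) P := by
  classical
  have h := hU.indep.indepFun_finset {e} (Finset.univ.erase e) (by simp) hU.measurable
  have h1 : Measurable fun x : (({e} : Finset (Fin n)) → ℝ) => x ⟨e, by simp⟩ :=
    measurable_pi_apply _
  have h2 : Measurable fun (x : {e' // e' ∈ Finset.univ.erase e} → ℝ) (e' : Fin n) =>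
      if he : e' = e then (0 : ℝ) else x ⟨e', by simp [he]⟩ :=
    measurable_pi_lambda _ fun e' => by
      split_ifs
      · exact measurable_const
      · exact measurable_pi_apply _
  have h' := h.comp h1 h2
  have h3 : (fun ω => Function.update (fun e => U e ω) e 0) = fun ω e' =>
      if he : e' = e then (0 : ℝ) else U e' ω := by
    funext ω e'
    by_cases he : e' = e
    · subst he
      simp
    · simp [he]
  rw [h3]
  exact h'

variable [IsProbabilityMeasure P]

theorem IsStochasticReward.integrable (hr : IsStochasticReward P r) (t : ℕ) (A : D) :
    Integrable (fun ω => r t ω A) P :=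
  Integrable.of_mem_Icc 0 1 (hr.measurable_apply t A).aemeasurable (hr.bounded t A)

theorem IsStochasticReward.meanReward_mem_Icc (hr : IsStochasticReward P r) (A : D) :
    meanReward P r A ∈ Set.Icc (0 : ℝ) 1 := by
  constructor
  · exact integral_nonneg_of_ae ((hr.bounded 0 A).mono fun ω h => h.1)
  · calc meanReward P r A ≤ ∫ _, (1 : ℝ) ∂P :=
          integral_mono_ae (hr.integrable 0 A) (integrable_const _)
            ((hr.bounded 0 A).mono fun ω h => h.2)
      _ = 1 := by simp

/-- The past rewards and a part of the seed are independent of the future rewards and another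
part of the seed. -/
theorem IsStochasticReward.indepFun_past_future_prodMk (hr : IsStochasticReward P r) {ι : Type*}
    {U : ι → Ω → ℝ} (hU : IsUniformSeed P r U) (a : ℕ) {γ δ : Type*} [MeasurableSpace γ]
    [MeasurableSpace δ] {φ : (ι → ℝ) → γ} {ψ : (ι → ℝ) → δ} (hφ : Measurable φ)
    (hψ : Measurable ψ) (h : IndepFun (fun ω => φ fun e => U e ω) (fun ω => ψ fun e => U e ω) P) :
    IndepFun (fun ω => ((fun i : Fin a => r i ω), φ fun e => U e ω))
      (fun ω => ((fun i => r (a + i) ω), ψ fun e => U e ω)) P := by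
  have hUm : Measurable fun ω e => U e ω := measurable_pi_lambda _ hU.measurable
  refine indepFun_prodMk_prodMk_of_indepFun
    (measurable_pi_lambda _ fun i => hr.measurable _)
    (measurable_pi_lambda _ fun i => hr.measurable _) (hφ.comp hUm) (hψ.comp hUm) ?_
    (hr.indepFun_past_future a) h
  exact hU.indep_rewards.comp
    (φ := fun ρ : ℕ → D → ℝ => ((fun i : Fin a => ρ i), fun i => ρ (a + i)))
    (ψ := fun u => (φ u, ψ u)) (by fun_prop) (hφ.prodMk hψ)

/-- Hoeffding's inequality for the empirical mean of rewards. -/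
theorem IsStochasticReward.measureReal_abs_empiricalMean_sub_ge_le (hr : IsStochasticReward P r)
    {m : ℕ} (hm : 0 < m) (A : D) {ε : ℝ} (hε : 0 ≤ ε) :
    P.real {ω | ε ≤ |empiricalMean m (fun i => r i ω) A - meanReward P r A|} ≤
      2 * Real.exp (-2 * m * ε ^ 2) := by
  have hm' : (0 : ℝ) < m := Nat.cast_pos.2 hm
  have hindep : iIndepFun (fun j ω => r j ω A - meanReward P r A) P :=
    hr.indep.comp (fun _ x => x A - meanReward P r A)
      fun _ => (measurable_pi_apply A).sub_const _
  -- Hoeffding's lemma: the parameter is the square of half the length of `[0, 1]`.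
  have hsub : ∀ j, HasSubgaussianMGF (fun ω => r j ω A - meanReward P r A) (1 / 4) P := by
    intro j
    have h := hasSubgaussianMGF_of_mem_Icc (hr.measurable_apply j A).aemeasurable (hr.bounded j A)
    rw [hr.integral_eq] at h
    convert h using 1
    simp
    norm_num
  have h1 := HasSubgaussianMGF.measure_sum_range_ge_le_of_iIndepFun hindep (n := m)
    (fun j _ => hsub j) (ε := m * ε) (by positivity)
  have hindep' : iIndepFun (fun j ω => -(r j ω A - meanReward P r A)) P :=
    hindep.comp (fun _ x => -x) fun _ => measurable_neg
  have h2 := HasSubgaussianMGF.measure_sum_range_ge_le_of_iIndepFun hindep' (n := m)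
    (fun j _ => (hsub j).neg) (ε := m * ε) (by positivity)
  have hexp : Real.exp (-(m * ε) ^ 2 / (2 * m * ((1 / 4 : NNReal) : ℝ))) =
      Real.exp (-2 * m * ε ^ 2) := by
    congr 1
    push_cast
    field_simp
    ring
  rw [hexp] at h1 h2
  refine (measureReal_mono (s₂ := {ω | m * ε ≤ ∑ j ∈ Finset.range m, (r j ω A - meanReward P r A)} ∪
    {ω | m * ε ≤ ∑ j ∈ Finset.range m, -(r j ω A - meanReward P r A)}) ?_).trans
    ((measureReal_union_le _ _).trans (by linarith))
  intro ω hω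
  have e : ∑ j ∈ Finset.range m, (r j ω A - meanReward P r A) =
      m * (empiricalMean m (fun i => r i ω) A - meanReward P r A) := by
    simp only [empiricalMean, Finset.sum_sub_distrib, Finset.sum_const, Finset.card_range,
      nsmul_eq_mul]
    field_simp
  simp only [Set.mem_union, Set.mem_ofPred_eq, Finset.sum_neg_distrib, e] at hω ⊢
  rcases le_abs.1 hω with h | h
  · exact Or.inl (mul_le_mul_of_nonneg_left h hm'.le)
  · right
    rw [← mul_neg]
    exact mul_le_mul_of_nonneg_left h hm'.le

/-- The expected excess of the estimation error over `ε`. -/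
theorem IsStochasticReward.integral_excess_le (hr : IsStochasticReward P r)
    {m : ℕ} (hm : 0 < m) (A : D) {ε : ℝ} (hε : 0 ≤ ε) :
    ∫ ω, max (|empiricalMean m (fun i => r i ω) A - meanReward P r A| - ε) 0 ∂P ≤
      2 * Real.exp (-2 * m * ε ^ 2) := by
  have hmeas : Measurable fun ω =>
      |empiricalMean m (fun i => r i ω) A - meanReward P r A| :=
    ((hr.measurable_empiricalMean_comp m A).sub_const _).abs
  have hset : MeasurableSet {ω | ε ≤ |empiricalMean m (fun i => r i ω) A - meanReward P r A|} :=
    measurableSet_le measurable_const hmeas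
  refine le_trans ?_ (hr.measureReal_abs_empiricalMean_sub_ge_le hm A hε)
  rw [← integral_indicator_one hset]
  refine integral_mono_of_nonneg (ae_of_all _ fun ω => le_max_right _ _)
    ((integrable_const (1 : ℝ)).indicator hset) ?_
  filter_upwards [hr.empiricalMean_mem_Icc m A] with ω hω
  have hμ := hr.meanReward_mem_Icc A
  have habs : |empiricalMean m (fun i => r i ω) A - meanReward P r A| ≤ 1 := by
    rw [abs_le]
    constructor <;> linarith [hω.1, hω.2, hμ.1, hμ.2]
  -- The error is at most 1, so its excess over `ε` is dominated by the indicator of the deviation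
  -- event.
  by_cases h : ε ≤ |empiricalMean m (fun i => r i ω) A - meanReward P r A|
  · rw [Set.indicator_of_mem (by exact h)]
    exact max_le (by simp only [Pi.one_apply]; linarith) zero_le_one
  · rw [Set.indicator_of_notMem (by exact h)]
    exact max_le (by linarith) le_rfl

end Rewards

/-! ### The expected value of the output -/

section ExpectedOutput

variable {n k : ℕ} {f : Assignment n k → ℝ} {σ : (Fin k → ℝ) → Equiv.Perm (Fin k)}

/-- The value of the solution `s'` plus the value of the reference solution `o`, changed at `e`
to agree with `s'`, minus a penalty for the error of the known value of `s'`. -/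
noncomputable def potential (f : Assignment n k → ℝ) (o : Assignment n k) (e : Fin n)
    (q : Assignment n k × ℝ) : ℝ :=
  f q.1 + f (Function.update o e (q.1 e)) - 5 * |q.2 - f q.1|

/-- One step of the algorithm with inexact answers: the potential decreases at most by a multiple
of the error of the answers. -/
theorem potential_step (hk : 2 ≤ k) (hf : IsKSubmodular f)
    (hσ : ∀ y : Fin k → ℝ, Antitone fun j => y (σ y j)) {s o : Assignment n k} {e : Fin n}
    (hs : s e = none) (ho : o e ≠ none) (hso : ∀ e', s e' = none ∨ s e' = o e') (v : ℝ)
    {w : Fin k → ℝ} {d : ℝ} (hd : ∀ i, |w i - f (Assignment.assign s e i)| ≤ d) :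
    f s + f o - 5 * |v - f s| - 10 * d ≤
      ∑ j, typeProb (fun j => w (σ (fun i => w i - v) j) - v) j *
        potential f o e (updateState e (some j) (σ fun i => w i - v) s v w) := by
  obtain ⟨t, ht⟩ := Option.ne_none_iff_exists'.1 ho
  have hz : Antitone fun j => w (σ (fun i => w i - v) j) - v := hσ fun i => w i - v
  generalize σ (fun i => w i - v) = π at hz ⊢
  obtain ⟨p, hp⟩ : ∃ p, p = typeProb (fun j => w (π j) - v) := ⟨_, rfl⟩
  have hp0 : ∀ j, 0 ≤ p j := hp ▸ typeProb_nonneg hz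
  have hp1 : ∑ j, p j = 1 := hp ▸ sum_typeProb hk hz
  have hd0 : 0 ≤ d := (abs_nonneg _).trans (hd t)
  -- Moving the reference from type `t` to another type is compared through `o'`, without a type at
  -- `e`. Its gains `a` are at most those of `s`, and any two of them have a nonnegative sum.
  obtain ⟨o', ho'⟩ : ∃ o', o' = Function.update o e none := ⟨_, rfl⟩
  have ho'e : o' e = none := by simp [ho']
  have hso' : ∀ e', s e' = none ∨ s e' = o' e' := by
    intro e'
    by_cases he : e' = e
    · left; rw [he, hs]
    · rw [ho', Function.update_of_ne he]
      exact hso e'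
  obtain ⟨a, ha⟩ : ∃ a : Fin k → ℝ, a = fun j => f (Assignment.assign o' e (π j)) - f o' :=
    ⟨_, rfl⟩
  have hd' : ∀ i, |w i - v - (f (Assignment.assign s e i) - f s)| ≤ d + |v - f s| := by
    intro i
    rw [show w i - v - (f (Assignment.assign s e i) - f s) =
      (w i - f (Assignment.assign s e i)) - (v - f s) by ring]
    exact (abs_sub _ _).trans (add_le_add_left (hd i) _)
  have key := sum_typeProb_exchange_le hk hz (a := a) (d := d + |v - f s|) (by positivity)
    (fun j => by
      have h1 := hf.assign_sub_antitone hso' ho'e (π j)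
      have h2 := (abs_le.1 (hd' (π j))).1
      rw [ha]
      dsimp only
      linarith)
    (fun i j hij => by
      have h := hf.pairwise_monotone ho'e (π.injective.ne hij)
      rw [ha]
      dsimp only
      linarith) (π.symm t)
  rw [← hp] at key ⊢
  have hat : a (π.symm t) = f o - f o' := by
    have : Assignment.assign o' e t = o := by
      rw [ho', Assignment.assign, Function.update_idem, ← ht, Function.update_eq_self]
    simp [ha, this]
  -- The true gain of `s` differs from the observed one by at most `d + |v - f s|`, and the new
  -- known value costs at most `5 * d`. With four times `d + |v - f s|` from `key`, this gives the
  -- coefficients 5 = 4 + 1 and 10 = 4 + 1 + 5.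
  have hterm : ∀ j, p j * (f s + f o + (w (π j) - v) - (d + |v - f s|) -
      (a (π.symm t) - a j) - 5 * d) ≤
      p j * potential f o e (updateState e (some j) π s v w) := by
    intro j
    refine mul_le_mul_of_nonneg_left ?_ (hp0 j)
    have h1 : Function.update o e (Assignment.assign s e (π j) e) =
        Assignment.assign o' e (π j) := by
      simp [ho', Assignment.assign]
    have haj : a j = f (Assignment.assign o' e (π j)) - f o' := by rw [ha]
    simp only [potential, updateState, h1, hat, haj]
    have h2 := (abs_le.1 (hd' (π j))).2
    have h3 := hd (π j)
    linarith
  refine le_trans ?_ (Finset.sum_le_sum fun j _ => hterm j)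
  have e1 : ∑ j, p j * (f s + f o + (w (π j) - v) - (d + |v - f s|) -
      (a (π.symm t) - a j) - 5 * d) = (f s + f o - (d + |v - f s|) - 5 * d) +
      ∑ j, p j * (w (π j) - v) - ∑ j, p j * (a (π.symm t) - a j) := by
    rw [← one_mul (f s + f o - (d + |v - f s|) - 5 * d), ← hp1, Finset.sum_mul,
      ← Finset.sum_add_distrib, ← Finset.sum_sub_distrib]
    exact Finset.sum_congr rfl fun j _ => by ring
  rw [e1]
  linarith

theorem measurable_potential (o : Assignment n k) (e : Fin n) :
    Measurable (potential f o e) := by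
  unfold potential
  have h1 : Measurable f := Measurable.of_discrete
  have h2 : Measurable fun x : Assignment n k => f (Function.update o e (x e)) :=
    Measurable.of_discrete
  exact ((h1.comp measurable_fst).add (h2.comp measurable_fst)).sub
    (((measurable_snd.sub (h1.comp measurable_fst)).abs).const_mul 5)

/-- The bound for the expected error of `k` empirical means of `m` rewards, where `ε` is the
accuracy of a single one. -/
noncomputable def meanError (k m : ℕ) (ε : ℝ) : ℝ := ε + k * (2 * Real.exp (-2 * m * ε ^ 2))

theorem meanError_nonneg (k m : ℕ) {ε : ℝ} (hε : 0 ≤ ε) : 0 ≤ meanError k m ε := by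
  unfold meanError
  positivity

theorem measurable_blockMeans (m : ℕ) (s : Assignment n k) (e : Fin n) :
    Measurable (blockMeans m s e) := by
  refine measurable_pi_lambda _ fun i => ?_
  unfold blockMeans
  fun_prop

theorem measurable_nextState_right (hσm : ∀ π, MeasurableSet {y | σ y = π}) (e : Fin n)
    (s : Assignment n k) (v : ℝ) :
    Measurable fun q : (Fin k → ℝ) × ℝ => nextState σ e s v q.1 q.2 :=
  (measurable_nextState hσm e).comp (f := fun q : (Fin k → ℝ) × ℝ => ((s, v), q))
    (measurable_const.prodMk measurable_id)

theorem abs_nextState_snd_le (e : Fin n) (s : Assignment n k) (v : ℝ) (w : Fin k → ℝ) (u : ℝ) :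
    |(nextState σ e s v w u).2| ≤ |v| + ∑ i, |w i| := by
  unfold nextState
  cases sampleIndex (typeProb fun j => w (σ (fun i => w i - v) j) - v) u with
  | none => exact le_add_of_nonneg_right (Finset.sum_nonneg fun i _ => abs_nonneg _)
  | some j =>
    refine (Finset.single_le_sum (f := fun i => |w i|) (fun i _ => abs_nonneg _)
      (Finset.mem_univ (σ (fun i => w i - v) j))).trans (le_add_of_nonneg_left (abs_nonneg _))

/-- The main loop never queries the empty assignment, so `f` may differ there from the mean reward.
-/
theorem assign_ne_empty (s : Assignment n k) (e : Fin n) (i : Fin k) :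
    Assignment.assign s e i ≠ Assignment.empty n k := by
  intro h
  have := congrFun h e
  simp [Assignment.assign, Assignment.empty] at this

variable {Ω : Type*} [MeasurableSpace Ω] {P : Measure Ω} [IsProbabilityMeasure P]

theorem integrable_of_measurable_of_abs_le {g : Ω → ℝ} (hg : Measurable g) {C : ℝ}
    (h : ∀ ω, |g ω| ≤ C) : Integrable g P :=
  Integrable.of_bound hg.aestronglyMeasurable C (ae_of_all _ h)

/-- The main loop, started with a partial solution `s` of known value `v`, compared with a reference
solution `o` extending `s`. -/
theorem le_integral_randomizedLoop (hk : 2 ≤ k) (hf : IsKSubmodular f)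
    (hf01 : ∀ x, f x ∈ Set.Icc (0 : ℝ) 1)
    (hσ : ∀ y : Fin k → ℝ, Antitone fun j => y (σ y j))
    (hσm : ∀ π, MeasurableSet {y | σ y = π}) {m : ℕ} (hm : 0 < m) {ε : ℝ} (hε : 0 ≤ ε)
    {U : Fin n → Ω → ℝ} {es : List (Fin n)} (hes : es.Nodup) {s o : Assignment n k}
    (hs : ∀ e ∈ es, s e = none) (ho : ∀ e ∈ es, o e ≠ none) (hso : ∀ e ∉ es, s e = o e)
    (v : ℝ) {r : ℕ → Ω → Assignment n k → ℝ} (hr : IsStochasticReward P r)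
    (hU : IsUniformSeed P r U)
    (hrf : ∀ x, x ≠ Assignment.empty n k → meanReward P r x = f x) :
    f s + f o - 5 * |v - f s| - 10 * es.length * meanError k m ε ≤
      ∫ ω, 2 * f (cetcOutput m (randomizedLoop σ (fun e => U e ω) es s v) fun i => r i ω) ∂P := by
  have hη := meanError_nonneg k m hε
  have hfabs : ∀ x, |f x| ≤ 1 := fun x => abs_le.2 ⟨by linarith [(hf01 x).1], (hf01 x).2⟩
  have hfm : Measurable f := Measurable.of_discrete
  induction es generalizing s o v r with
  | nil =>
    have : s = o := funext fun e => hso e (by simp)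
    simp [randomizedLoop, cetcOutput, this]
    linarith [abs_nonneg (v - f o)]
  | cons e es ih =>
    rw [List.nodup_cons] at hes
    have hse := hs e (by simp)
    have hoe := ho e (by simp)
    have hUm : Measurable fun ω e => U e ω := measurable_pi_lambda _ hU.measurable
    have hrm : Measurable fun ω i => r i ω := measurable_pi_lambda _ hr.measurable
    have hWm : Measurable fun ω => blockMeans m s e fun i => r i ω :=
      (measurable_blockMeans m s e).comp hrm
    have hW1 : ∀ᵐ ω ∂P, ∀ i, blockMeans m s e (fun i => r i ω) i ∈ Set.Icc (0 : ℝ) 1 :=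
      ae_all_iff.2 fun i => (hr.shift (i * m)).empiricalMean_mem_Icc m (Assignment.assign s e i)
    have hnext := measurable_nextState_right hσm e s v
    have hXm : Measurable fun ω =>
        nextState σ e s v (blockMeans m s e fun i => r i ω) (U e ω) :=
      hnext.comp (f := fun ω => (blockMeans m s e fun i => r i ω, U e ω))
        (hWm.prodMk (hU.measurable e))
    -- `G` bounds from below the expected final value given the state after `e`. The induction
    -- hypothesis covers only states that gave `e` a type; elsewhere 0 is a valid bound.
    obtain ⟨G, hGdef⟩ : ∃ G : Assignment n k × ℝ → ℝ, G = fun q =>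
        if ∃ i, q.1 = Assignment.assign s e i then
          potential f o e q - 10 * es.length * meanError k m ε else 0 := ⟨_, rfl⟩
    have hGm : Measurable G := by
      rw [hGdef]
      refine Measurable.ite ?_ ((measurable_potential o e).sub_const _) measurable_const
      exact measurable_fst (MeasurableSet.of_discrete
        (s := {x : Assignment n k | ∃ i, x = Assignment.assign s e i}))
    have hGi : Integrable (fun ω =>
        G (nextState σ e s v (blockMeans m s e fun i => r i ω) (U e ω))) P := by
      refine Integrable.of_bound (hGm.comp hXm).aestronglyMeasurable
        (2 + 5 * (|v| + k + 1) + 10 * es.length * meanError k m ε) ?_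
      filter_upwards [hW1] with ω hω
      have hv := abs_nextState_snd_le (σ := σ) e s v (blockMeans m s e fun i => r i ω) (U e ω)
      have hsum : ∑ i, |blockMeans m s e (fun i => r i ω) i| ≤ k := by
        calc ∑ i, |blockMeans m s e (fun i => r i ω) i| ≤ ∑ _i : Fin k, (1 : ℝ) :=
              Finset.sum_le_sum fun i _ => by
                rw [abs_of_nonneg (hω i).1]
                exact (hω i).2
          _ = k := by simp
      generalize nextState σ e s v (blockMeans m s e fun i => r i ω) (U e ω) = q at hv ⊢
      have hnn : 0 ≤ 10 * es.length * meanError k m ε := by positivity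
      rw [Real.norm_eq_abs, hGdef]
      dsimp only
      split_ifs
      · have h1 := hf01 q.1
        have h2 := hf01 (Function.update o e (q.1 e))
        have h3 : |q.2 - f q.1| ≤ |v| + k + 1 := by
          have := abs_sub q.2 (f q.1)
          have := hfabs q.1
          linarith
        have h4 := abs_nonneg (q.2 - f q.1)
        rw [potential, abs_le]
        constructor <;> linarith [h1.1, h1.2, h2.1, h2.2]
      · rw [abs_zero]
        positivity
    -- the remaining elements
    have hstep1 : ∫ ω, G (nextState σ e s v (blockMeans m s e fun i => r i ω) (U e ω)) ∂P ≤
        ∫ ω, 2 * f (cetcOutput m (randomizedLoop σ (fun e => U e ω) (e :: es) s v)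
          fun i => r i ω) ∂P := by
      have hout : ∀ (q : Assignment n k × ℝ) (u : Fin n → ℝ),
          randomizedLoop σ (Function.update u e 0) es q.1 q.2 = randomizedLoop σ u es q.1 q.2 :=
        fun q u => randomizedLoop_congr σ (fun e' he' =>
          Function.update_of_ne (by rintro rfl; exact hes.1 he') _ _) _ _
      have hF : Measurable fun p : (Assignment n k × ℝ) ×
          ((ℕ → Assignment n k → ℝ) × (Fin n → ℝ)) =>
          2 * f (cetcOutput m (randomizedLoop σ p.2.2 es p.1.1 p.1.2) p.2.1) := by
        refine (hfm.comp ?_).const_mul 2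
        exact ((measurableFamily_randomizedLoop hσm es).measurable_cetcOutput
          (fun θ => hasQueryCount_randomizedLoop σ _ es _ _) m).comp
          (f := fun p : (Assignment n k × ℝ) × ((ℕ → Assignment n k → ℝ) × (Fin n → ℝ)) =>
            ((p.1, p.2.2), p.2.1)) (by fun_prop)
      have hZm : Measurable fun ω => ((fun i => r (k * m + i) ω),
          Function.update (fun e => U e ω) e 0) := by
        refine Measurable.prodMk (measurable_pi_lambda _ fun i => hr.measurable _) ?_
        exact (measurable_update_left (a := e) (x := (0 : ℝ))).comp hUm
      have hind : IndepFun
          (fun ω => nextState σ e s v (blockMeans m s e fun i => r i ω) (U e ω))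
          (fun ω => ((fun i => r (k * m + i) ω), Function.update (fun e => U e ω) e 0)) P := by
        have h := hr.indepFun_past_future_prodMk hU (k * m) (φ := fun u => u e)
          (ψ := fun u => Function.update u e 0) (measurable_pi_apply e)
          measurable_update_left (hU.indepFun_update e)
        -- The finite past is extended by zero to a sequence; the block means do not see the
        -- extension.
        have hφm : Measurable fun p : (Fin (k * m) → Assignment n k → ℝ) × ℝ =>
            nextState σ e s v (blockMeans m s e fun i =>
              if hi : i < k * m then p.1 ⟨i, hi⟩ else 0) p.2 := by
          have hext : Measurable fun (x : Fin (k * m) → Assignment n k → ℝ) (i : ℕ) =>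
              if hi : i < k * m then x ⟨i, hi⟩ else 0 := by
            refine measurable_pi_lambda _ fun i => ?_
            split_ifs
            · exact measurable_pi_apply _
            · exact measurable_const
          exact hnext.comp (f := fun p : (Fin (k * m) → Assignment n k → ℝ) × ℝ =>
            (blockMeans m s e fun i => if hi : i < k * m then p.1 ⟨i, hi⟩ else 0, p.2))
            (((measurable_blockMeans m s e).comp (hext.comp measurable_fst)).prodMk measurable_snd)
        have hW : ∀ ω, (blockMeans m s e fun i => if i < k * m then r i ω else 0) =
            blockMeans m s e fun i => r i ω := by
          intro ω
          funext i
          unfold blockMeans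
          congr 1
          refine Finset.sum_congr rfl fun j hj => ?_
          have h1 : (i : ℕ) * m + j < k * m := by
            have h2 := Finset.mem_range.1 hj
            have h3 : ((i : ℕ) + 1) * m ≤ k * m := Nat.mul_le_mul_right _ i.2
            rw [Nat.succ_mul] at h3
            omega
          dsimp only
          rw [if_pos h1]
        have h' := h.comp hφm measurable_id
        simp only [Function.comp_def, id, dite_eq_ite, hW] at h'
        exact h'
      refine (integral_le_integral_of_indepFun hXm hZm hind hF ?_ hGm hGi ?_).trans_eq ?_
      · refine integrable_of_measurable_of_abs_le (C := 2) (hF.comp (hXm.prodMk hZm)) fun ω => ?_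
        rw [abs_mul, abs_two]
        linarith [hfabs (cetcOutput m (randomizedLoop σ (Function.update (fun e => U e ω) e 0) es
          (nextState σ e s v (blockMeans m s e fun i => r i ω) (U e ω)).1
          (nextState σ e s v (blockMeans m s e fun i => r i ω) (U e ω)).2)
          fun i => r (k * m + i) ω)]
      · intro q
        simp only [hout]
        rw [hGdef]
        dsimp only
        split_ifs with hq
        · obtain ⟨i, hi⟩ := hq
          have h := ih hes.2 (s := q.1) (o := Function.update o e (q.1 e)) ?_ ?_ ?_ q.2
            (hr.shift (k * m)) (hU.shift (k * m))
            (fun x hx => by rw [hr.meanReward_shift, hrf x hx])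
          · exact h
          · intro e' he'
            have hne : e' ≠ e := by rintro rfl; exact hes.1 he'
            rw [hi, Assignment.assign, Function.update_of_ne hne]
            exact hs e' (by simp [he'])
          · intro e' he'
            have hne : e' ≠ e := by rintro rfl; exact hes.1 he'
            rw [Function.update_of_ne hne]
            exact ho e' (by simp [he'])
          · intro e' he'
            by_cases hne : e' = e
            · rw [hne, Function.update_self]
            · rw [Function.update_of_ne hne, hi, Assignment.assign, Function.update_of_ne hne]
              exact hso e' (by simp [he', hne])
        · exact integral_nonneg fun ω => mul_nonneg zero_le_two (hf01 _).1
      · simp only [hout, cetcOutput_randomizedLoop_cons]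
    refine le_trans ?_ hstep1
    -- the step for `e`
    obtain ⟨d, hddef⟩ : ∃ d : (Fin k → ℝ) → ℝ, d = fun w =>
        ε + ∑ i, max (|w i - f (Assignment.assign s e i)| - ε) 0 := ⟨_, rfl⟩
    have hdm : Measurable d := by
      rw [hddef]
      fun_prop
    -- Adding up the excesses over `ε` controls all `k` errors at once, with expectation at most
    -- `meanError`.
    have hd : ∀ w i, |w i - f (Assignment.assign s e i)| ≤ d w := by
      intro w i
      have h1 := Finset.single_le_sum
        (f := fun i => max (|w i - f (Assignment.assign s e i)| - ε) 0)
        (fun i _ => le_max_right _ _) (Finset.mem_univ i)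
      have h2 := le_max_left (|w i - f (Assignment.assign s e i)| - ε) 0
      rw [hddef]
      dsimp only at h1 ⊢
      linarith
    have hexi : ∀ i, Integrable (fun ω =>
        max (|blockMeans m s e (fun i => r i ω) i - f (Assignment.assign s e i)| - ε) 0) P := by
      intro i
      have hmeas : Measurable fun ω => blockMeans m s e (fun i => r i ω) i :=
        (measurable_pi_apply i).comp hWm
      refine Integrable.of_bound (C := 1)
        (((hmeas.sub_const _).abs.sub_const _).max measurable_const).aestronglyMeasurable ?_
      filter_upwards [hW1] with ω hω
      have h1 := hω i
      have h2 := hf01 (Assignment.assign s e i)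
      have h3 : |blockMeans m s e (fun i => r i ω) i - f (Assignment.assign s e i)| ≤ 1 := by
        rw [abs_le]
        constructor <;> linarith [h1.1, h1.2, h2.1, h2.2]
      rw [Real.norm_eq_abs, abs_of_nonneg (le_max_right _ _)]
      exact max_le (by linarith) zero_le_one
    have hdi : Integrable (fun ω => d (blockMeans m s e fun i => r i ω)) P := by
      rw [hddef]
      exact (integrable_const _).add (integrable_finsetSum _ fun i _ => hexi i)
    have hdint : ∫ ω, d (blockMeans m s e fun i => r i ω) ∂P ≤ meanError k m ε := by
      rw [hddef]
      dsimp only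
      rw [integral_add (integrable_const _) (integrable_finsetSum _ fun i _ => hexi i),
        integral_finsetSum _ fun i _ => hexi i, integral_const, probReal_univ, one_smul, meanError]
      gcongr
      calc ∑ i, ∫ ω, max (|blockMeans m s e (fun i => r i ω) i -
              f (Assignment.assign s e i)| - ε) 0 ∂P
          ≤ ∑ _i : Fin k, 2 * Real.exp (-2 * m * ε ^ 2) := by
            refine Finset.sum_le_sum fun i _ => ?_
            have h := (hr.shift (i * m)).integral_excess_le hm (Assignment.assign s e i) hε
            rw [hr.meanReward_shift, hrf _ (assign_ne_empty s e i)] at h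
            exact h
        _ = k * (2 * Real.exp (-2 * m * ε ^ 2)) := by simp
    have hindWU : IndepFun (fun ω => blockMeans m s e fun i => r i ω) (U e) P :=
      hU.indep_rewards.comp (measurable_blockMeans m s e) (measurable_pi_apply e)
    have hstep2 := integral_le_integral_of_indepFun (P := P) hWm (hU.measurable e) hindWU
      (F := fun q => G (nextState σ e s v q.1 q.2)) (hGm.comp hnext) hGi
      (G := fun w => f s + f o - 5 * |v - f s| - 10 * es.length * meanError k m ε - 10 * d w)
      (by fun_prop) ((integrable_const _).sub (hdi.const_mul 10)) ?_
    · refine le_trans ?_ hstep2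
      rw [integral_sub (integrable_const _) (hdi.const_mul 10), integral_const_mul]
      simp only [integral_const, probReal_univ, one_smul, List.length_cons]
      push_cast
      linarith
    · intro w
      obtain ⟨p, hp⟩ : ∃ p, p = typeProb (fun j => w (σ (fun i => w i - v) j) - v) := ⟨_, rfl⟩
      have hz : Antitone fun j => w (σ (fun i => w i - v) j) - v := hσ fun i => w i - v
      have hp0 : ∀ j, 0 ≤ p j := hp ▸ typeProb_nonneg hz
      have hp1 : ∑ j, p j = 1 := hp ▸ sum_typeProb hk hz
      -- With the answers `w` fixed, only the uniform seed of `e` is random, and the integral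
      -- becomes the weighted sum of `potential_step`.
      have hmap : ∫ ω, G (nextState σ e s v w (U e ω)) ∂P =
          ∫ u in Set.Icc (0 : ℝ) 1, G (nextState σ e s v w u) := by
        rw [← hU.uniform e, integral_map (hU.measurable e).aemeasurable]
        exact (hGm.comp (hnext.comp
          (measurable_const.prodMk measurable_id))).aestronglyMeasurable
      have hsample := integral_sampleIndex hp0 hp1
        fun oj => G (updateState e oj (σ fun i => w i - v) s v w)
      have hGsome : ∀ j, G (updateState e (some j) (σ fun i => w i - v) s v w) =
          potential f o e (updateState e (some j) (σ fun i => w i - v) s v w) -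
            10 * es.length * meanError k m ε := by
        intro j
        rw [hGdef]
        exact if_pos ⟨_, rfl⟩
      rw [hmap]
      simp only [nextState, ← hp]
      rw [hsample]
      simp only [hGsome, mul_sub (p _), Finset.sum_sub_distrib, ← Finset.sum_mul, hp1, one_mul]
      have hstep := potential_step hk hf hσ hse hoe (fun e' => ?_) v (hd w)
      · rw [← hp] at hstep
        linarith
      · by_cases he' : e' ∈ e :: es
        · exact Or.inl (hs e' he')
        · exact Or.inr (hso e' he')

end ExpectedOutput

/-! ### The regret of C-ETC -/

section Regret

variable {n k : ℕ} {σ : (Fin k → ℝ) → Equiv.Perm (Fin k)}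
  {Ω : Type*} [MeasurableSpace Ω] {P : Measure Ω}
  {r : ℕ → Ω → Assignment n k → ℝ} {U : Fin n → Ω → ℝ}

theorem IsStochasticReward.ae_mem_Icc (hr : IsStochasticReward P r) (t : ℕ) :
    ∀ᵐ ω ∂P, ∀ A, r t ω A ∈ Set.Icc (0 : ℝ) 1 := ae_all_iff.2 fun A => hr.bounded t A

variable [IsProbabilityMeasure P]

theorem measurable_cetcOutput_randomized (hσm : ∀ π, MeasurableSet {y | σ y = π}) (b : Bool)
    (ord : Equiv.Perm (Fin n)) (m : ℕ) :
    Measurable fun p : (Fin n → ℝ) × (ℕ → Assignment n k → ℝ) =>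
      cetcOutput m (randomizedKSubmodularMax b ord σ p.1) p.2 :=
  (measurableFamily_randomizedKSubmodularMax hσm b ord).measurable_cetcOutput
    (fun u => hasQueryCount_randomizedKSubmodularMax σ b ord u) m

/-- The expected absolute error of an empirical mean. -/
theorem IsStochasticReward.integral_abs_empiricalMean_sub_le (hr : IsStochasticReward P r)
    (hk : 1 ≤ k) {m : ℕ} (hm : 0 < m) {ε : ℝ} (hε : 0 ≤ ε) (A : Assignment n k) :
    Integrable (fun ω => |empiricalMean m (fun i => r i ω) A - meanReward P r A|) P ∧
      ∫ ω, |empiricalMean m (fun i => r i ω) A - meanReward P r A| ∂P ≤ meanError k m ε := by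
  have hmeas := hr.measurable_empiricalMean_comp m A
  have hb : ∀ᵐ ω ∂P, |empiricalMean m (fun i => r i ω) A - meanReward P r A| ≤ 1 := by
    filter_upwards [hr.empiricalMean_mem_Icc m A] with ω hω
    have hμ := hr.meanReward_mem_Icc A
    rw [abs_le]
    constructor <;> linarith [hω.1, hω.2, hμ.1, hμ.2]
  have hi1 : Integrable (fun ω => |empiricalMean m (fun i => r i ω) A - meanReward P r A|) P := by
    refine Integrable.of_bound (hmeas.sub_const _).abs.aestronglyMeasurable 1 ?_
    filter_upwards [hb] with ω hω
    rwa [Real.norm_eq_abs, abs_abs]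
  have hi2 : Integrable
      (fun ω => max (|empiricalMean m (fun i => r i ω) A - meanReward P r A| - ε) 0) P :=
    (hi1.sub (integrable_const ε)).pos_part
  refine ⟨hi1, ?_⟩
  calc ∫ ω, |empiricalMean m (fun i => r i ω) A - meanReward P r A| ∂P
      ≤ ∫ ω, (ε + max (|empiricalMean m (fun i => r i ω) A - meanReward P r A| - ε) 0) ∂P := by
        refine integral_mono hi1 ((integrable_const _).add hi2) fun ω => ?_
        have := le_max_left (|empiricalMean m (fun i => r i ω) A - meanReward P r A| - ε) 0
        dsimp only
        linarith
    _ ≤ ε + 2 * Real.exp (-2 * m * ε ^ 2) := by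
        rw [integral_add (integrable_const _) hi2, integral_const, probReal_univ, one_smul]
        gcongr
        exact hr.integral_excess_le hm A hε
    _ ≤ meanError k m ε := by
        have : (1 : ℝ) ≤ k := by exact_mod_cast hk
        exact add_le_add le_rfl (le_mul_of_one_le_left (by positivity) this)

/-- The expected value of the output of the randomized algorithm run by C-ETC. -/
theorem le_integral_cetcOutput_randomized (hn : 1 ≤ n) (hk : 2 ≤ k)
    (hσ : ∀ y : Fin k → ℝ, Antitone fun j => y (σ y j))
    (hσm : ∀ π, MeasurableSet {y | σ y = π}) (hr : IsStochasticReward P r)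
    (hU : IsUniformSeed P r U) (hf : IsKSubmodular (meanReward P r)) {m : ℕ} (hm : 0 < m) {ε : ℝ}
    (hε : 0 ≤ ε) (b : Bool) (ord : Equiv.Perm (Fin n)) (opt : Assignment n k) :
    meanReward P r opt - (10 * n + 5) * meanError k m ε ≤
      ∫ ω, 2 * meanReward P r (cetcOutput m
        (randomizedKSubmodularMax b ord σ fun e => U e ω) fun i => r i ω) ∂P := by
  have hη := meanError_nonneg k m hε
  have hUm : Measurable fun ω e => U e ω := measurable_pi_lambda _ hU.measurable
  have hrm : Measurable fun ω i => r i ω := measurable_pi_lambda _ hr.measurable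
  have hμ := hr.meanReward_mem_Icc
  obtain ⟨o, ho, hopt⟩ := hf.exists_total_le hk opt
  have hnodup : ((List.finRange n).map ord).Nodup := (List.nodup_finRange n).map ord.injective
  have hmem : ∀ e, e ∈ (List.finRange n).map ord := fun e =>
    List.mem_map.2 ⟨ord.symm e, List.mem_finRange _, ord.apply_symm_apply e⟩
  have hlen : ((List.finRange n).map ord).length = n := by simp
  have hbound : ∀ f : Assignment n k → ℝ, (∀ x, f x ∈ Set.Icc (0 : ℝ) 1) →
      ∀ x, |2 * f x| ≤ 2 := by
    intro f hf x
    rw [abs_le]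
    constructor <;> linarith [(hf x).1, (hf x).2]
  cases b with
  | false =>
    -- Setting the value of the empty assignment to 0 makes the normalized initial value exact. The
    -- total reference `o` is nonempty because `n ≥ 1`, and passing back from `g` to the mean reward
    -- only increases the value of the output.
    obtain ⟨g, hg⟩ : ∃ g, g = Function.update (meanReward P r) (Assignment.empty n k) 0 :=
      ⟨_, rfl⟩
    have hg0 : g (Assignment.empty n k) = 0 := by simp [hg]
    have hgne : ∀ x, x ≠ Assignment.empty n k → meanReward P r x = g x := by
      intro x hx
      rw [hg, Function.update_of_ne hx]
    have hgle : ∀ x, g x ≤ meanReward P r x := by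
      intro x
      by_cases hx : x = Assignment.empty n k
      · rw [hx, hg0]
        exact (hμ _).1
      · exact (hgne x hx).ge
    have hg01 : ∀ x, g x ∈ Set.Icc (0 : ℝ) 1 := by
      intro x
      by_cases hx : x = Assignment.empty n k
      · simp [hx, hg0]
      · rw [← hgne x hx]
        exact hμ x
    have hone : o ≠ Assignment.empty n k := fun h => ho ⟨0, hn⟩ (by rw [h]; rfl)
    have hmain := le_integral_randomizedLoop (f := g) hk (hg ▸ hf.update_empty (hμ _).1) hg01 hσ hσm
      hm hε hnodup (s := Assignment.empty n k) (o := o) (fun _ _ => rfl) (fun e _ => ho e)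
      (fun e he => absurd (hmem e) he) 0 hr hU hgne
    rw [hg0, ← hgne o hone, hlen] at hmain
    have hmono : ∫ ω, 2 * g (cetcOutput m (randomizedLoop σ (fun e => U e ω)
        ((List.finRange n).map ord) (Assignment.empty n k) 0) fun i => r i ω) ∂P ≤
        ∫ ω, 2 * meanReward P r (cetcOutput m
          (randomizedKSubmodularMax false ord σ fun e => U e ω) fun i => r i ω) ∂P := by
      have hout := (measurable_cetcOutput_randomized (n := n) hσm false ord m).comp
        (hUm.prodMk hrm)
      refine integral_mono
        (integrable_of_measurable_of_abs_le (C := 2)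
          (((Measurable.of_discrete (f := g)).comp hout).const_mul 2)
          fun ω => hbound g hg01 _)
        (integrable_of_measurable_of_abs_le (C := 2)
          (((Measurable.of_discrete (f := meanReward P r)).comp hout).const_mul 2)
          fun ω => hbound _ hμ _)
        fun ω => mul_le_mul_of_nonneg_left (hgle _) zero_le_two
    simp only [sub_zero, abs_zero, mul_zero, zero_add] at hmain
    linarith
  | true =>
    have hXm := hr.measurable_empiricalMean_comp m (Assignment.empty n k)
    have hZm : Measurable fun ω => ((fun i => r (m + i) ω), fun e => U e ω) :=
      (measurable_pi_lambda _ fun i => hr.measurable _).prodMk hUm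
    have hind : IndepFun (fun ω => empiricalMean m (fun i => r i ω) (Assignment.empty n k))
        (fun ω => ((fun i => r (m + i) ω), fun e => U e ω)) P := by
      have h := hr.indepFun_past_future_prodMk hU m (φ := fun _ => (0 : ℝ)) (ψ := fun u => u)
        measurable_const measurable_id (indepFun_const_left _ _)
      have hφ : Measurable fun p : (Fin m → Assignment n k → ℝ) × ℝ =>
          (∑ j, p.1 j (Assignment.empty n k)) / m := by fun_prop
      have h' := h.comp hφ measurable_id
      have hsum : ∀ ω, ∑ j : Fin m, r j ω (Assignment.empty n k) =
          ∑ j ∈ Finset.range m, r j ω (Assignment.empty n k) := fun ω =>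
        Fin.sum_univ_eq_sum_range (fun j => r j ω (Assignment.empty n k)) m
      simp only [Function.comp_def, id, hsum] at h'
      exact h'
    have hF : Measurable fun p : ℝ × ((ℕ → Assignment n k → ℝ) × (Fin n → ℝ)) =>
        2 * meanReward P r (cetcOutput m (randomizedLoop σ p.2.2 ((List.finRange n).map ord)
          (Assignment.empty n k) p.1) p.2.1) := by
      refine ((Measurable.of_discrete (f := meanReward P r)).comp ?_).const_mul 2
      exact ((measurableFamily_randomizedLoop hσm ((List.finRange n).map ord)).measurable_cetcOutput
        (fun θ => hasQueryCount_randomizedLoop σ _ _ _ _) m).comp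
        (f := fun p : ℝ × ((ℕ → Assignment n k → ℝ) × (Fin n → ℝ)) =>
          (((Assignment.empty n k, p.1), p.2.2), p.2.1)) (by fun_prop)
    -- The initial value is a noisy answer here; its error accounts for the 5 in `10 * n + 5`.
    obtain ⟨habsi, habs⟩ := hr.integral_abs_empiricalMean_sub_le (by omega) hm hε
      (Assignment.empty n k)
    have hkey := integral_le_integral_of_indepFun hXm hZm hind hF
      (integrable_of_measurable_of_abs_le (C := 2) (hF.comp (hXm.prodMk hZm))
        fun ω => hbound _ hμ _)
      (G := fun v => meanReward P r (Assignment.empty n k) + meanReward P r o -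
        10 * n * meanError k m ε - 5 * |v - meanReward P r (Assignment.empty n k)|)
      ((measurable_const).sub (((measurable_id.sub_const _).abs).const_mul 5))
      ((integrable_const _).sub (habsi.const_mul 5)) (fun v => by
        have h := le_integral_randomizedLoop hk hf hμ hσ hσm hm hε hnodup
          (s := Assignment.empty n k) (o := o) (fun _ _ => rfl) (fun e _ => ho e)
          (fun e he => absurd (hmem e) he) v (hr.shift m) (hU.shift m)
          (fun x _ => by rw [hr.meanReward_shift])
        rw [hlen] at h
        refine le_trans (le_of_eq ?_) h
        ring)
    rw [integral_sub (integrable_const _) (habsi.const_mul 5), integral_const_mul, integral_const,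
      probReal_univ, one_smul] at hkey
    have h0 := (hμ (Assignment.empty n k)).1
    refine le_trans ?_ hkey
    linarith

theorem measurable_eval_assignment :
    Measurable fun q : (Assignment n k → ℝ) × Assignment n k => q.1 q.2 :=
  measurable_from_prod_countable_left fun y => measurable_pi_apply y

theorem integrable_reward_apply (hr : IsStochasticReward P r) (t : ℕ) {A : Ω → Assignment n k}
    (hA : Measurable A) : Integrable (fun ω => r t ω (A ω)) P := by
  refine Integrable.of_mem_Icc 0 1 ?_ ((hr.ae_mem_Icc t).mono fun ω h => h _)
  exact (measurable_eval_assignment.comp ((hr.measurable t).prodMk hA)).aemeasurable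

/-- After the exploration, the expected reward is the expected value of the output. -/
theorem integral_output_le_integral_reward (hσm : ∀ π, MeasurableSet {y | σ y = π})
    (hr : IsStochasticReward P r) (hU : IsUniformSeed P r U) (m : ℕ) (b : Bool)
    (ord : Equiv.Perm (Fin n)) {t : ℕ} (ht : (n * k + if b then 1 else 0) * m ≤ t) :
    ∫ ω, meanReward P r (cetcOutput m (randomizedKSubmodularMax b ord σ fun e => U e ω)
        fun i => r i ω) ∂P ≤
      ∫ ω, r t ω (cetcOutput m (randomizedKSubmodularMax b ord σ fun e => U e ω)
        fun i => r i ω) ∂P := by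
  have hUm : Measurable fun ω e => U e ω := measurable_pi_lambda _ hU.measurable
  have hrm : Measurable fun ω i => r i ω := measurable_pi_lambda _ hr.measurable
  have hout := measurable_cetcOutput_randomized (n := n) hσm b ord m
  have hX : Measurable fun ω => cetcOutput m
      (randomizedKSubmodularMax b ord σ fun e => U e ω) fun i => r i ω :=
    hout.comp (f := fun ω => ((fun e => U e ω), fun i => r i ω)) (hUm.prodMk hrm)
  obtain ⟨a, ha⟩ : ∃ a, a = (n * k + if b then 1 else 0) * m := ⟨_, rfl⟩
  rw [← ha] at ht
  have hind : IndepFun (fun ω => cetcOutput m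
      (randomizedKSubmodularMax b ord σ fun e => U e ω) fun i => r i ω) (r t) P := by
    have h := hr.indepFun_past_future_prodMk hU a (φ := fun u => u) (ψ := fun _ => (0 : ℝ))
      measurable_id measurable_const (indepFun_const_right _ _)
    have hφ : Measurable fun p : (Fin a → Assignment n k → ℝ) × (Fin n → ℝ) =>
        cetcOutput m (randomizedKSubmodularMax b ord σ p.2)
          fun i => if hi : i < a then p.1 ⟨i, hi⟩ else 0 := by
      have hext : Measurable fun (x : Fin a → Assignment n k → ℝ) (i : ℕ) =>
          if hi : i < a then x ⟨i, hi⟩ else 0 := by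
        refine measurable_pi_lambda _ fun i => ?_
        split_ifs
        · exact measurable_pi_apply _
        · exact measurable_const
      exact hout.comp (f := fun p : (Fin a → Assignment n k → ℝ) × (Fin n → ℝ) =>
        (p.2, fun i => if hi : i < a then p.1 ⟨i, hi⟩ else 0))
        (measurable_snd.prodMk (hext.comp measurable_fst))
    have hψ : Measurable fun p : (ℕ → Assignment n k → ℝ) × ℝ => p.1 (t - a) := by fun_prop
    have h' := h.comp hφ hψ
    have hcongr : ∀ ω, cetcOutput m (randomizedKSubmodularMax b ord σ fun e => U e ω)
        (fun i => if i < a then r i ω else 0) =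
        cetcOutput m (randomizedKSubmodularMax b ord σ fun e => U e ω) fun i => r i ω :=
      fun ω => cetcOutput_congr (hasQueryCount_randomizedKSubmodularMax σ b ord _)
        fun i hi => if_pos (ha ▸ hi)
    simp only [Function.comp_def, dite_eq_ite, hcongr, Nat.add_sub_cancel' ht] at h'
    exact h'
  refine integral_le_integral_of_indepFun (F := fun p : Assignment n k × (Assignment n k → ℝ) =>
    p.2 p.1) hX (hr.measurable t) hind (measurable_eval_assignment.comp measurable_swap)
    (integrable_reward_apply hr t hX) (G := meanReward P r) Measurable.of_discrete ?_
    fun x => (hr.integral_eq t x).ge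
  refine integrable_of_measurable_of_abs_le (C := 1)
    ((Measurable.of_discrete (f := meanReward P r)).comp hX) fun ω => ?_
  have := hr.meanReward_mem_Icc (cetcOutput m
    (randomizedKSubmodularMax b ord σ fun e => U e ω) fun i => r i ω)
  exact abs_le.2 ⟨by linarith [this.1], this.2⟩

/-- The regret of C-ETC with `m` repetitions per query, for the randomized algorithm. -/
theorem integrable_and_expectedRegret_le (hn : 1 ≤ n) (hk : 2 ≤ k)
    (hσ : ∀ y : Fin k → ℝ, Antitone fun j => y (σ y j))
    (hσm : ∀ π, MeasurableSet {y | σ y = π}) (hr : IsStochasticReward P r)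
    (hU : IsUniformSeed P r U) (hf : IsKSubmodular (meanReward P r)) {m : ℕ} (hm : 0 < m) {ε : ℝ}
    (hε : 0 ≤ ε) (b : Bool) (ord : Equiv.Perm (Fin n)) (opt : Assignment n k) (T : ℕ) :
    Integrable (totalReward r (fun t ω => cetcAction m
        (randomizedKSubmodularMax b ord σ fun e => U e ω) (fun i => r i ω) t) T) P ∧
      expectedRegret P (1 / 2) r (fun t ω => cetcAction m
        (randomizedKSubmodularMax b ord σ fun e => U e ω) (fun i => r i ω) t) T opt ≤
        (n * k + 1) * m + 8 * n * T * meanError k m ε := by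
  have hη := meanError_nonneg k m hε
  have hUm : Measurable fun ω e => U e ω := measurable_pi_lambda _ hU.measurable
  have hrm : Measurable fun ω i => r i ω := measurable_pi_lambda _ hr.measurable
  have hA : ∀ t, Measurable fun ω => cetcAction m
      (randomizedKSubmodularMax b ord σ fun e => U e ω) (fun i => r i ω) t := fun t =>
    (measurableFamily_randomizedKSubmodularMax hσm b ord m t).comp
      (f := fun ω => ((fun e => U e ω), fun i => r i ω)) (hUm.prodMk hrm)
  have hint := fun t => integrable_reward_apply hr t (hA t)
  refine ⟨integrable_finsetSum _ fun t _ => hint t, ?_⟩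
  have hsum : ∫ ω, totalReward r (fun t ω => cetcAction m
      (randomizedKSubmodularMax b ord σ fun e => U e ω) (fun i => r i ω) t) T ω ∂P =
      ∑ t ∈ Finset.range T, ∫ ω, r t ω (cetcAction m
        (randomizedKSubmodularMax b ord σ fun e => U e ω) (fun i => r i ω) t) ∂P :=
    integral_finsetSum _ fun t _ => hint t
  rw [expectedRegret, hsum]
  have hn' : (1 : ℝ) ≤ n := by exact_mod_cast hn
  have hround : ∀ t ∈ Finset.range T, 1 / 2 * meanReward P r opt -
      ∫ ω, r t ω (cetcAction m (randomizedKSubmodularMax b ord σ fun e => U e ω)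
        (fun i => r i ω) t) ∂P ≤
      -- `n * k + 1` covers the queries of both variants, and half of `10 * n + 5` is at most `8 *
      -- n`.
      (if t < (n * k + 1) * m then 1 else 0) + 8 * n * meanError k m ε := by
    intro t _
    split_ifs with ht
    · have h1 := (hr.meanReward_mem_Icc opt).2
      have h2 : 0 ≤ ∫ ω, r t ω (cetcAction m
          (randomizedKSubmodularMax b ord σ fun e => U e ω) (fun i => r i ω) t) ∂P :=
        integral_nonneg_of_ae ((hr.ae_mem_Icc t).mono fun ω h => (h _).1)
      have h3 : 0 ≤ 8 * n * meanError k m ε := by positivity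
      linarith
    · have ht' : (n * k + if b then 1 else 0) * m ≤ t := by
        refine le_trans (Nat.mul_le_mul_right m ?_) (not_lt.1 ht)
        split_ifs <;> omega
      have h1 := le_integral_cetcOutput_randomized hn hk hσ hσm hr hU hf hm hε b ord opt
      have h2 := integral_output_le_integral_reward hσm hr hU m b ord ht'
      rw [integral_const_mul] at h1
      simp only [cetcAction_eq_cetcOutput
        (hasQueryCount_randomizedKSubmodularMax σ b ord _) _ ht']
      nlinarith
  have htotal := Finset.sum_le_sum hround
  rw [Finset.sum_sub_distrib, Finset.sum_add_distrib, Finset.sum_const, Finset.sum_const,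
    Finset.card_range, nsmul_eq_mul, nsmul_eq_mul] at htotal
  have hcard : ∑ t ∈ Finset.range T, (if t < (n * k + 1) * m then (1 : ℝ) else 0) ≤
      (n * k + 1) * m := by
    rw [← Finset.sum_filter, Finset.sum_const, nsmul_eq_mul, mul_one]
    have : (Finset.filter (fun t => t < (n * k + 1) * m) (Finset.range T)).card ≤
        (n * k + 1) * m := by
      refine (Finset.card_le_card (t := Finset.range ((n * k + 1) * m)) fun t ht => ?_).trans_eq
        (Finset.card_range _)
      exact Finset.mem_range.2 (Finset.mem_filter.1 ht).2
    exact_mod_cast this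
  linarith

/-- The choice of the number of repetitions balances the costs of exploration and exploitation. -/
theorem exists_cetcRepetitions_bound {n k T : ℕ} (hn : 1 ≤ n) (hk : 2 ≤ k) (hT : n * k ≤ T) :
    0 < cetcRepetitions (20 * n) (n * k) T ∧ ∃ ε : ℝ, 0 ≤ ε ∧
      (n * k + 1) * (cetcRepetitions (20 * n) (n * k) T : ℝ) +
        8 * n * T * meanError k (cetcRepetitions (20 * n) (n * k) T) ε ≤
      100 * (n * (k : ℝ) ^ (1 / 3 : ℝ) * (T : ℝ) ^ (2 / 3 : ℝ) * Real.log T ^ (1 / 3 : ℝ)) := by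
  have hkT : k ≤ T := (Nat.le_mul_of_pos_left k hn).trans hT
  have hn' : (1 : ℝ) ≤ n := by exact_mod_cast hn
  have hk' : (2 : ℝ) ≤ k := by exact_mod_cast hk
  have hkT' : (k : ℝ) ≤ T := by exact_mod_cast hkT
  have hT' : (n * k : ℝ) ≤ T := by exact_mod_cast hT
  have hL : Real.log 2 ≤ Real.log T := Real.log_le_log (by norm_num) (hk'.trans hkT')
  have hL0 : 0 ≤ Real.log T := le_trans (Real.log_nonneg (by norm_num)) hL
  have cube : ∀ x : ℝ, 0 ≤ x → (x ^ (1 / 3 : ℝ)) ^ 3 = x := by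
    intro x hx
    rw [← Real.rpow_natCast, ← Real.rpow_mul hx]
    norm_num
  have square : ∀ x : ℝ, 0 ≤ x → x ^ (2 / 3 : ℝ) = (x ^ (1 / 3 : ℝ)) ^ 2 := by
    intro x hx
    rw [← Real.rpow_natCast, ← Real.rpow_mul hx]
    norm_num
  -- The factors `n ^ (2 / 3)` of the robustness parameter and of the query bound cancel.
  have hm : (cetcRepetitions (20 * n) (n * k) T : ℕ) =
      ⌈(20 : ℝ) ^ (2 / 3 : ℝ) * (T : ℝ) ^ (2 / 3 : ℝ) * Real.log T ^ (1 / 3 : ℝ) /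
        (2 * (k : ℝ) ^ (2 / 3 : ℝ))⌉₊ := by
    unfold cetcRepetitions
    congr 1
    rw [Real.mul_rpow (by norm_num) (by positivity), Real.mul_rpow (by positivity) (by positivity)]
    have : (n : ℝ) ^ (2 / 3 : ℝ) ≠ 0 := by positivity
    have : (k : ℝ) ^ (2 / 3 : ℝ) ≠ 0 := by positivity
    field_simp
  have hc1 : (1 : ℝ) ≤ 20 ^ (2 / 3 : ℝ) := Real.one_le_rpow (by norm_num) (by norm_num)
  have hc2 : (20 : ℝ) ^ (2 / 3 : ℝ) ≤ 20 := by
    calc (20 : ℝ) ^ (2 / 3 : ℝ) ≤ 20 ^ (1 : ℝ) :=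
          Real.rpow_le_rpow_of_exponent_le (by norm_num) (by norm_num)
      _ = 20 := Real.rpow_one _
  rw [square T (by positivity), square k (by positivity)] at hm
  rw [square T (by positivity)]
  have hκ3 := cube k (by positivity)
  have hτ3 := cube T (by positivity)
  have hl3 := cube (Real.log T) hL0
  have hκ1 : 1 ≤ (k : ℝ) ^ (1 / 3 : ℝ) := Real.one_le_rpow (by linarith) (by norm_num)
  have hκτ : (k : ℝ) ^ (1 / 3 : ℝ) ≤ (T : ℝ) ^ (1 / 3 : ℝ) :=
    Real.rpow_le_rpow (by positivity) hkT' (by norm_num)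
  have hl0 : 0 ≤ Real.log T ^ (1 / 3 : ℝ) := Real.rpow_nonneg hL0 _
  generalize (k : ℝ) ^ (1 / 3 : ℝ) = κ at *
  generalize (T : ℝ) ^ (1 / 3 : ℝ) = τ at *
  generalize Real.log T ^ (1 / 3 : ℝ) = l at *
  generalize (20 : ℝ) ^ (2 / 3 : ℝ) = c at *
  have hl : 1 / 2 ≤ l := by
    by_contra h
    have h1 : l ^ 3 < (1 / 2) ^ 3 := pow_lt_pow_left₀ (not_le.1 h) hl0 (by norm_num)
    have := Real.log_two_gt_d9
    norm_num at h1
    linarith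
  have hκ0 : 0 < κ := by linarith
  have hτ1 : 1 ≤ τ := hκ1.trans hκτ
  have hτ0 : 0 < τ := by linarith
  generalize cetcRepetitions (20 * n) (n * k) T = m at *
  have hx0 : 0 < c * τ ^ 2 * l / (2 * κ ^ 2) := by
    have : 0 < c := by linarith
    have : 0 < l := by linarith
    positivity
  have hm1 : c * τ ^ 2 * l / (2 * κ ^ 2) ≤ m := hm ▸ Nat.le_ceil _
  have hm2 : (m : ℝ) ≤ c * τ ^ 2 * l / (2 * κ ^ 2) + 1 := hm ▸ (Nat.ceil_lt_add_one hx0.le).le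
  -- This accuracy gives `m * ε ^ 2 ≥ l ^ 3 = log T`, hence a deviation term of at most `1 / T ^ 2`,
  -- while `n * T * ε` is exactly `2 * B`.
  refine ⟨by rw [hm]; exact Nat.ceil_pos.2 hx0, 2 * κ * l / τ, by positivity, ?_⟩
  obtain ⟨B, hB⟩ : ∃ B : ℝ, B = n * κ * τ ^ 2 * l := ⟨_, rfl⟩
  rw [← hB]
  have hκτ2 : κ ^ 2 ≤ τ ^ 2 := pow_le_pow_left₀ hκ0.le hκτ 2
  have hexplore : (n * k + 1) * (m : ℝ) ≤ 24 * B := by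
    have h1 : (n * k + 1 : ℝ) ≤ 2 * (n * κ ^ 3) := by
      rw [hκ3]
      nlinarith
    have h2 : (m : ℝ) ≤ 20 * τ ^ 2 * l / (2 * κ ^ 2) + 1 := by
      refine hm2.trans ?_
      gcongr
    calc (n * k + 1) * (m : ℝ) ≤ 2 * (n * κ ^ 3) * (20 * τ ^ 2 * l / (2 * κ ^ 2) + 1) := by
          gcongr
      _ = 20 * B + 2 * (n * κ * κ ^ 2) := by
          rw [hB]
          field_simp
      -- The rounding up of `m` is absorbed by means of `k ≤ T` and `2 * l ≥ 1`.
      _ ≤ 20 * B + 2 * (n * κ * (τ ^ 2 * (2 * l))) := by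
          gcongr
          nlinarith [sq_nonneg τ]
      _ = 24 * B := by rw [hB]; ring
  have hexp : Real.exp (-2 * m * (2 * κ * l / τ) ^ 2) ≤ 1 / (T : ℝ) ^ 2 := by
    have hT0 : (0 : ℝ) < T := by linarith
    have h1 : Real.log T ≤ m * (2 * κ * l / τ) ^ 2 := by
      calc Real.log T = l ^ 3 := hl3.symm
        _ ≤ 1 * τ ^ 2 * l / (2 * κ ^ 2) * (2 * κ * l / τ) ^ 2 := by
            rw [show 1 * τ ^ 2 * l / (2 * κ ^ 2) * (2 * κ * l / τ) ^ 2 = 2 * l ^ 3 by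
              field_simp]
            linarith [pow_nonneg hl0 3]
        _ ≤ c * τ ^ 2 * l / (2 * κ ^ 2) * (2 * κ * l / τ) ^ 2 := by gcongr
        _ ≤ m * (2 * κ * l / τ) ^ 2 := by gcongr
    calc Real.exp (-2 * m * (2 * κ * l / τ) ^ 2) ≤ Real.exp (-(Real.log T + Real.log T)) := by
          apply Real.exp_le_exp.2
          linarith
      _ = 1 / (T : ℝ) ^ 2 := by
          rw [Real.exp_neg, Real.exp_add, Real.exp_log hT0, one_div, sq]
  have hexploit : n * T * meanError k m (2 * κ * l / τ) ≤ 6 * B := by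
    have hT0 : (0 : ℝ) < T := by linarith
    have h1 : n * T * (2 * κ * l / τ) = 2 * B := by
      rw [hB, ← hτ3]
      field_simp
    have h2 : n * T * (k * (2 * (1 / (T : ℝ) ^ 2))) = 2 * (n * k / T) := by
      field_simp
    have h3 : (n * k : ℝ) / T ≤ 1 := (div_le_one hT0).2 hT'
    have h4 : 1 / 2 ≤ B := by
      rw [hB]
      have : 1 ≤ n * κ * τ ^ 2 := by
        have h5 : 1 ≤ n * κ := one_le_mul_of_one_le_of_one_le hn' hκ1
        exact one_le_mul_of_one_le_of_one_le h5 (one_le_pow₀ hτ1)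
      nlinarith
    calc n * T * meanError k m (2 * κ * l / τ)
        ≤ n * T * (2 * κ * l / τ + k * (2 * (1 / (T : ℝ) ^ 2))) := by
          unfold meanError
          gcongr
      _ = 2 * B + 2 * (n * k / T) := by rw [mul_add, h1, h2]
      _ ≤ 6 * B := by linarith
  -- The total is `24 * B + 8 * (6 * B) = 72 * B`, within the constant 100.
  have h6 : 0 ≤ B := by rw [hB]; positivity
  linarith

end Regret

theorem mainTheorem1 :
    ∃ C : ℝ, 0 < C ∧
      ∀ (n k T : ℕ), 1 ≤ n → 2 ≤ k → n * k ≤ T →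
      -- the algorithm: order of the elements, sorting rule, treatment of the empty assignment
      ∀ (queryEmpty : Bool) (ord : Equiv.Perm (Fin n)) (σ : (Fin k → ℝ) → Equiv.Perm (Fin k)),
        (∀ y : Fin k → ℝ, Antitone fun j => y (σ y j)) → (∀ π, MeasurableSet {y | σ y = π}) →
      -- the environment
      ∀ (Ω : Type*) [MeasurableSpace Ω] (P : Measure Ω) [IsProbabilityMeasure P]
        (r : ℕ → Ω → Assignment n k → ℝ) (U : Fin n → Ω → ℝ),
        IsStochasticReward P r → IsUniformSeed P r U → IsKSubmodular (meanReward P r) →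
      ∀ opt : Assignment n k, (∀ x, meanReward P r x ≤ meanReward P r opt) →
        Integrable (totalReward r (cetcRandomized queryEmpty ord σ r U T) T) P ∧
        expectedRegret P (1 / 2) r (cetcRandomized queryEmpty ord σ r U T) T opt ≤
          C * (n * (k : ℝ) ^ (1 / 3 : ℝ) * (T : ℝ) ^ (2 / 3 : ℝ) * Real.log T ^ (1 / 3 : ℝ)) := by
  refine ⟨100, by norm_num, ?_⟩
  intro n k T hn hk hT b ord σ hσ hσm Ω _ P _ r U hr hU hf opt _
  obtain ⟨hm, ε, hε, hbound⟩ := exists_cetcRepetitions_bound hn hk hT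
  obtain ⟨h1, h2⟩ := integrable_and_expectedRegret_le hn hk hσ hσm hr hU hf hm hε b ord opt T
  exact ⟨h1, h2.trans hbound⟩
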